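/- **Setting.** Formulas of propositional logic are built from atoms by $\bot,\lor,\land,\supset$; a cedent is a finite set of formulas; a sequent $\Gamma\Rightarrow\alpha$ consists of a cedent $\Gamma$ and a formula $\alpha$. The natural deduction calculus NJp has the axioms $\alpha,\Gamma\Rightarrow\alpha$, and $\bot,\Gamma\Rightarrow p$ for atoms $p$, and the usual introduction and elimination rules for $\lor,\land,\supset$ on sequents. A *(cut)-deduction* from a set $\mathcal S$ of sequents is a finite tree of sequents whose leaves belong to $\mathcal S$ and each of whose inferences derives $\Gamma,\Delta\Rightarrow\alpha$ from $\Gamma\Rightarrow\beta$ and $\beta,\Delta\Rightarrow\alpha$. A subsequent of $\Gamma\Rightarrow\alpha$ is a sequent $\Gamma'\Rightarrow\alpha$ with $\Gamma'\subseteq\Gamma$. An occurrence of a subformula in $\alpha$ is *strictly positive* if it is $\alpha$ itself, or $\alpha$ is $\alpha_0\lor\alpha_1$ or $\alpha_0\land\alpha_1$ and it is strictly positive in $\alpha_0$ or in $\alpha_1$, or $\alpha$ is $\alpha_0\supset\alpha_1$ and it is strictly positive in $\alpha_1$. For a cedent $\Gamma$, let $\Gamma_\lor^+$ be the set of strictly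 positive occurrences of disjunctive formulas in the formulas of $\Gamma$, and $n_\Gamma$ its cardinality. An enumeration $\{\beta^j_0\lor\beta^j_1: j<n_\Gamma\}$ of $\Gamma_\lor^+$ without repetition is *admissible* if no occurrence lies inside a later one. Relative to an admissible enumeration, a number $k=\sum_{j<n_\Gamma}k_j2^j<2^{n_\Gamma}$ with $k_j\in\{0,1\}$ is identified with the choice of the disjunct $\beta^j_{k_j}$ in $\beta^j_0\lor\beta^j_1$ for each $j$. For $\gamma\in\Gamma$, the formula $\gamma(k)$ is obtained from $\gamma$ by replacing each strictly positive occurrence $\beta^j_0\lor\beta^j_1$ by the chosen disjunct $\beta^j_{k_j}$, larger occurrences first, and $\Gamma(k)=\{\gamma(k):\gamma\in\Gamma\}$. **Statement.** 1. There is a polynomial time algorithm that, given a cedent $\Gamma$, yields an admissible enumeration of $\Gamma_\lor^+$. 2. There is a polynomial time computable transformation that takes an NJp-derivation $d$ of a sequent $\Gamma\Rightarrow\alpha_0\lor\alpha_1$ ($\Gamma$ arbitrary), an admissible enumeration of $\Gamma_\lor^+$ and a number $k<2^{n_\Gamma}$ to an NJp-derivation $d(k)$ of $\Gamma(k)\Rightarrow\alpha_0\lor\alpha_1$.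 3. For every such transformation $d,k\mapsto d(k)$ there is a polynomial time algorithm running as follows. Given an NJp-derivation $d$ of a sequent $\Gamma\Rightarrow\alpha_0\lor\alpha_1$, an admissible enumeration of $\Gamma_\lor^+$ and a number $k<2^{n_\Gamma}$, the algorithm yields an $i\in\{0,1\}$ and a (cut)-deduction of a subsequent $\Gamma(k)'\Rightarrow\alpha_i$ of $\Gamma(k)\Rightarrow\alpha_i$ from the set of sequents occurring in $d(k)$. -/

import Mathlib

namespace IPC

/-! ### Formulas, cedents, sequents -/

/-- Formulas of propositional logic; atoms are indexed by natural numbers. -/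
inductive Formula : Type
  | var (n : ℕ)
  | bot
  | or (a b : Formula)
  | and (a b : Formula)
  | imp (a b : Formula)
  deriving DecidableEq

/-- Cedents are finite sets of formulas. -/
abbrev Cedent : Type := Finset Formula

/-- The sequent `ant ⇒ succ`. -/
structure Sequent : Type where
  ant : Cedent
  succ : Formula

/-! ### Strictly positive occurrences and the strengthening of a cedent -/

/-- A position in a formula: the path from the root, `false` leading to the left and `true` to the
right immediate subformula. -/
abbrev Pos : Type := List Bool

/-- `SPos α p β`: at position `p` there is a strictly positive occurrence of `β` in `α`. -/
inductive SPos : Formula → Pos → Formula → Prop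
  | here (α : Formula) : SPos α [] α
  | orL {a b β : Formula} {p : Pos} : SPos a p β → SPos (.or a b) (false :: p) β
  | orR {a b β : Formula} {p : Pos} : SPos b p β → SPos (.or a b) (true :: p) β
  | andL {a b β : Formula} {p : Pos} : SPos a p β → SPos (.and a b) (false :: p) β
  | andR {a b β : Formula} {p : Pos} : SPos b p β → SPos (.and a b) (true :: p) β
  | impR {a b β : Formula} {p : Pos} : SPos b p β → SPos (.imp a b) (true :: p) β

/-- An occurrence of a subformula in a cedent: a formula of the cedent and a position in it. -/
abbrev Occ : Type := Formula × Pos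

/-- The set `Γ_∨⁺` of strictly positive occurrences of disjunctive formulas in the cedent `Γ`. -/
def Cedent.disjOcc (Γ : Cedent) : Set Occ :=
  {o | o.1 ∈ Γ ∧ ∃ β₀ β₁, SPos o.1 o.2 (.or β₀ β₁)}

/-- The number `n_Γ` of strictly positive occurrences of disjunctive formulas in `Γ`. -/
noncomputable def Cedent.numDisj (Γ : Cedent) : ℕ := Γ.disjOcc.ncard

/-- The occurrence `o` lies inside the occurrence `o'`. -/
def Occ.Inside (o o' : Occ) : Prop := o.1 = o'.1 ∧ o'.2 <+: o.2

/-- `E` enumerates `Γ_∨⁺` without repetition, and no occurrence lies inside a later one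
(so longer occurrences come before the ones that lie inside them). -/
def IsEnumeration (Γ : Cedent) (E : List Occ) : Prop :=
  E.Nodup ∧ (∀ o, o ∈ E ↔ o ∈ Γ.disjOcc) ∧ E.Pairwise (fun o o' => ¬ o.Inside o')

/-- Replace every strictly positive disjunction of a formula by one of its disjuncts, larger
occurrences first: `c p` says which disjunct is taken at the position `p` of the original formula
(`false`: the left one, `true`: the right one). Choices at positions inside a disjunct that
has been dropped are not used. -/
def Formula.choose : Formula → (Pos → Bool) → Formula
  | .var n, _ => .var n
  | .bot, _ => .bot
  | .or a b, c =>
      if c [] then b.choose (fun p => c (true :: p)) else a.choose (fun p => c (false :: p))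
  | .and a b, c => .and (a.choose (fun p => c (false :: p))) (b.choose (fun p => c (true :: p)))
  | .imp a b, c => .imp a (b.choose (fun p => c (true :: p)))

/-- The choice coded by the binary digits of `k`: at the `j`-th occurrence of the enumeration `E`
take the disjunct with the index `k_j`. -/
def choice (E : List Occ) (k : ℕ) (γ : Formula) (p : Pos) : Bool := k.testBit (E.idxOf (γ, p))

/-- The strengthened cedent `Γ(k) = {γ(k) : γ ∈ Γ}`, relative to the enumeration `E`. -/
def Cedent.strengthen (Γ : Cedent) (E : List Occ) (k : ℕ) : Cedent :=
  Γ.image (fun γ => γ.choose (choice E k γ))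

/-! ### Natural deduction and cut-deductions -/

/-- Trees of sequents labelled with the rules of the natural deduction calculus `NJp`; the first
sequent is the conclusion. In `orI` and `andE` the Boolean is the index `i` of the rule. -/
inductive Derivation : Type
  | ax (s : Sequent)
  | botAx (s : Sequent)
  | orE (s : Sequent) (d d₀ d₁ : Derivation)
  | orI (i : Bool) (s : Sequent) (d : Derivation)
  | andE (i : Bool) (s : Sequent) (d : Derivation)
  | andI (s : Sequent) (d₀ d₁ : Derivation)
  | impE (s : Sequent) (d e : Derivation)
  | impI (s : Sequent) (d : Derivation)

namespace Derivation

/-- The conclusion. -/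
def concl : Derivation → Sequent
  | ax s => s
  | botAx s => s
  | orE s _ _ _ => s
  | orI _ s _ => s
  | andE _ s _ => s
  | andI s _ _ => s
  | impE s _ _ => s
  | impI s _ => s

/-- Every step is an axiom or an inference of `NJp`. The axioms are `α, Γ ⇒ α`, and `⊥, Γ ⇒ p` for
atoms `p`. -/
def Correct : Derivation → Prop
  | ax s => s.succ ∈ s.ant
  | botAx s => Formula.bot ∈ s.ant ∧ ∃ n, s.succ = .var n
  | orE s d d₀ d₁ =>
      (∃ α₀ α₁, d.concl = ⟨s.ant, .or α₀ α₁⟩ ∧ d₀.concl = ⟨insert α₀ s.ant, s.succ⟩ ∧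
        d₁.concl = ⟨insert α₁ s.ant, s.succ⟩) ∧ d.Correct ∧ d₀.Correct ∧ d₁.Correct
  | orI i s d =>
      (∃ α₀ α₁, s.succ = .or α₀ α₁ ∧ d.concl = ⟨s.ant, if i then α₁ else α₀⟩) ∧ d.Correct
  | andE i s d =>
      (∃ α₀ α₁, d.concl = ⟨s.ant, .and α₀ α₁⟩ ∧ s.succ = if i then α₁ else α₀) ∧ d.Correct
  | andI s d₀ d₁ =>
      (∃ α₀ α₁, s.succ = .and α₀ α₁ ∧ d₀.concl = ⟨s.ant, α₀⟩ ∧ d₁.concl = ⟨s.ant, α₁⟩) ∧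
        d₀.Correct ∧ d₁.Correct
  | impE s d e =>
      (∃ α, d.concl = ⟨s.ant, .imp α s.succ⟩ ∧ e.concl = ⟨s.ant, α⟩) ∧ d.Correct ∧ e.Correct
  | impI s d =>
      (∃ α β, s.succ = .imp α β ∧ d.concl = ⟨insert α s.ant, β⟩) ∧ d.Correct

/-- The set of sequents occurring in a derivation. -/
def sequents : Derivation → Set Sequent
  | ax s => {s}
  | botAx s => {s}
  | orE s d d₀ d₁ => {s} ∪ d.sequents ∪ d₀.sequents ∪ d₁.sequents
  | orI _ s d => {s} ∪ d.sequents
  | andE _ s d => {s} ∪ d.sequents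
  | andI s d₀ d₁ => {s} ∪ d₀.sequents ∪ d₁.sequents
  | impE s d e => {s} ∪ d.sequents ∪ e.sequents
  | impI s d => {s} ∪ d.sequents

/-- `d` is an `NJp`-derivation of `Γ ⇒ α`. -/
def Derives (d : Derivation) (Γ : Cedent) (α : Formula) : Prop := d.Correct ∧ d.concl = ⟨Γ, α⟩

end Derivation

/-- Trees of sequents whose only inference rule is the cut. -/
inductive CutDeduction : Type
  | start (s : Sequent)
  | cut (s : Sequent) (d e : CutDeduction)

namespace CutDeduction

/-- The conclusion. -/
def concl : CutDeduction → Sequent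
  | start s => s
  | cut s _ _ => s

/-- The deduction starts from sequents in `S`, and every inference infers `Γ, Δ ⇒ α` from
`Γ ⇒ β` and `β, Δ ⇒ α`. -/
def CorrectFrom (S : Set Sequent) : CutDeduction → Prop
  | start s => s ∈ S
  | cut s d e =>
      (∃ Γ Δ β α, d.concl = ⟨Γ, β⟩ ∧ e.concl = ⟨insert β Δ, α⟩ ∧ s = ⟨Γ ∪ Δ, α⟩) ∧
        d.CorrectFrom S ∧ e.CorrectFrom S

end CutDeduction

/-! ### Computation with a step count

Data are binary trees. Programs are those of a first-order functional language with recursion. -/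

/-- Binary trees, the data of the computations. -/
inductive Tree : Type
  | nil
  | node (l r : Tree)
  deriving DecidableEq

/-- The number of nodes of a tree, leaves included. -/
def Tree.size : Tree → ℕ
  | .nil => 1
  | .node l r => l.size + r.size + 1

/-- Programs; each one maps a tree to a tree. `call` calls the innermost enclosing procedure `mu p`
(or the whole program, if there is none). -/
inductive Prog : Type
  | nil
  | id
  | left
  | right
  | eq
  | cons (p q : Prog)
  | comp (q p : Prog)
  | ite (c p q : Prog)
  | call
  | mu (p : Prog)

/-- `Runs b p x y t`: inside a procedure with the body `b`, the program `p` terminates on the input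
`x` with the output `y` at the cost `t`. The cost is the sum, over all the steps of the
evaluation, of one plus the size of the tree to which the step is applied. -/
inductive Runs : Prog → Prog → Tree → Tree → ℕ → Prop
  | nil (b : Prog) (x : Tree) : Runs b .nil x .nil (x.size + 1)
  | id (b : Prog) (x : Tree) : Runs b .id x x (x.size + 1)
  | leftNil (b : Prog) : Runs b .left .nil .nil (Tree.nil.size + 1)
  | leftNode (b : Prog) (l r : Tree) : Runs b .left (.node l r) l ((Tree.node l r).size + 1)
  | rightNil (b : Prog) : Runs b .right .nil .nil (Tree.nil.size + 1)
  | rightNode (b : Prog) (l r : Tree) : Runs b .right (.node l r) r ((Tree.node l r).size + 1)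
  | eqNil (b : Prog) : Runs b .eq .nil .nil (Tree.nil.size + 1)
  | eqNode (b : Prog) (l r : Tree) :
      Runs b .eq (.node l r) (if l = r then .node .nil .nil else .nil) ((Tree.node l r).size + 1)
  | cons {b p q : Prog} {x y z : Tree} {s t : ℕ} :
      Runs b p x y s → Runs b q x z t → Runs b (.cons p q) x (.node y z) (s + t + (x.size + 1))
  | comp {b p q : Prog} {x y z : Tree} {s t : ℕ} :
      Runs b p x y s → Runs b q y z t → Runs b (.comp q p) x z (s + t + (x.size + 1))
  | iteNode {b c p q : Prog} {x l r y : Tree} {s t : ℕ} :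
      Runs b c x (.node l r) s → Runs b p x y t → Runs b (.ite c p q) x y (s + t + (x.size + 1))
  | iteNil {b c p q : Prog} {x y : Tree} {s t : ℕ} :
      Runs b c x .nil s → Runs b q x y t → Runs b (.ite c p q) x y (s + t + (x.size + 1))
  | call {b : Prog} {x y : Tree} {t : ℕ} :
      Runs b b x y t → Runs b .call x y (t + (x.size + 1))
  | mu {b p : Prog} {x y : Tree} {t : ℕ} :
      Runs p p x y t → Runs b (.mu p) x y (t + (x.size + 1))

/-- A search problem is given by a relation `R` between instances and solutions, both presented by
trees that code them (an object may have several codes, e.g. a finite set one for each list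
of its elements). It is solvable in polynomial time if there is a program that, from every
code of every instance, computes a code of a solution, at a cost polynomial in the size of the code
of the instance. -/
def SolvableInPolyTime {X Y : Type} (codeX : X → Tree → Prop) (codeY : Y → Tree → Prop)
    (R : X → Y → Prop) : Prop :=
  ∃ (p : Prog) (B : Polynomial ℕ), ∀ (x : X) (w : Tree), codeX x w →
    ∃ (y : Y) (v : Tree) (t : ℕ), R x y ∧ codeY y v ∧ Runs p p w v t ∧ t ≤ B.eval w.size

/-! ### Codes -/

/-- The tree coding a list of trees. -/
def Tree.ofList : List Tree → Tree
  | [] => .nil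
  | a :: l => .node a (Tree.ofList l)

/-- Labels of nodes. -/
def Tree.label : ℕ → Tree
  | 0 => .nil
  | n + 1 => .node .nil (Tree.label n)

/-- The code of a truth value. -/
def Tree.ofBool : Bool → Tree
  | false => .nil
  | true => .node .nil .nil

/-- The code of a string of bits. -/
def Tree.ofBits (l : List Bool) : Tree := Tree.ofList (l.map Tree.ofBool)

/-- The code of a natural number: its string of binary digits, the lowest one first. -/
def Tree.ofNat (n : ℕ) : Tree := Tree.ofBits n.bits

/-- The code of a formula. -/
def Formula.code : Formula → Tree
  | .var n => .node (.label 0) (.ofNat n)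
  | .bot => .node (.label 1) .nil
  | .or a b => .node (.label 2) (.node a.code b.code)
  | .and a b => .node (.label 3) (.node a.code b.code)
  | .imp a b => .node (.label 4) (.node a.code b.code)

/-- The code of an occurrence. -/
def Occ.code (o : Occ) : Tree := .node o.1.code (.ofBits o.2)

/-- The code of a list of occurrences. -/
def enumCode (E : List Occ) : Tree := .ofList (E.map Occ.code)

/-- A cedent is coded by every list of its elements, in any order. -/
def Cedent.IsCode (Γ : Cedent) (w : Tree) : Prop :=
  ∃ l : List Formula, l.toFinset = Γ ∧ w = .ofList (l.map Formula.code)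

/-- Codes of a sequent. -/
def Sequent.IsCode (s : Sequent) (w : Tree) : Prop :=
  ∃ v, s.ant.IsCode v ∧ w = .node v s.succ.code

/-- Codes of a derivation: label of the last rule, conclusion, list of the subderivations. -/
def Derivation.IsCode : Derivation → Tree → Prop
  | .ax s, w => ∃ v, s.IsCode v ∧ w = .node (.label 0) (.node v (.ofList []))
  | .botAx s, w => ∃ v, s.IsCode v ∧ w = .node (.label 1) (.node v (.ofList []))
  | .orE s d d₀ d₁, w => ∃ v a a₀ a₁, s.IsCode v ∧ d.IsCode a ∧ d₀.IsCode a₀ ∧ d₁.IsCode a₁ ∧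
      w = .node (.label 2) (.node v (.ofList [a, a₀, a₁]))
  | .orI i s d, w => ∃ v a, s.IsCode v ∧ d.IsCode a ∧
      w = .node (.label (if i then 4 else 3)) (.node v (.ofList [a]))
  | .andE i s d, w => ∃ v a, s.IsCode v ∧ d.IsCode a ∧
      w = .node (.label (if i then 6 else 5)) (.node v (.ofList [a]))
  | .andI s d₀ d₁, w => ∃ v a₀ a₁, s.IsCode v ∧ d₀.IsCode a₀ ∧ d₁.IsCode a₁ ∧
      w = .node (.label 7) (.node v (.ofList [a₀, a₁]))
  | .impE s d e, w => ∃ v a a', s.IsCode v ∧ d.IsCode a ∧ e.IsCode a' ∧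
      w = .node (.label 8) (.node v (.ofList [a, a']))
  | .impI s d, w => ∃ v a, s.IsCode v ∧ d.IsCode a ∧
      w = .node (.label 9) (.node v (.ofList [a]))

/-- Codes of a cut-deduction. -/
def CutDeduction.IsCode : CutDeduction → Tree → Prop
  | .start s, w => ∃ v, s.IsCode v ∧ w = .node (.label 0) (.node v (.ofList []))
  | .cut s d e, w => ∃ v a a', s.IsCode v ∧ d.IsCode a ∧ e.IsCode a' ∧
      w = .node (.label 1) (.node v (.ofList [a, a']))

/-! ### The generalized disjunction property as a search problem -/

/-- An instance: an `NJp`-derivation `d` of a sequent `Γ ⇒ α₀ ∨ α₁`, an enumeration `E` of `Γ_∨⁺`,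
and a number `k < 2 ^ n_Γ`, i.e. a choice of disjuncts. -/
structure Instance : Type where
  Γ : Cedent
  α₀ : Formula
  α₁ : Formula
  d : Derivation
  E : List Occ
  k : ℕ
  derives : d.Derives Γ (.or α₀ α₁)
  enumerates : IsEnumeration Γ E
  k_lt : k < 2 ^ Γ.numDisj

/-- The strengthened antecedent `Γ(k)`. -/
def Instance.strengthened (x : Instance) : Cedent := x.Γ.strengthen x.E x.k

/-- Codes of an instance. Note that `Γ`, `α₀`, `α₁` can be read off from `d`. -/
def Instance.IsCode (x : Instance) (w : Tree) : Prop :=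
  ∃ a, x.d.IsCode a ∧ w = .node a (.node (enumCode x.E) (.ofNat x.k))

/-- `T` is a polynomial time computable transformation of the given derivation `d` of
`Γ ⇒ α₀ ∨ α₁` and the choice `k` into an `NJp`-derivation `d(k)` of `Γ(k) ⇒ α₀ ∨ α₁`. -/
def IsPolyTimeTransformation (T : Instance → Derivation) : Prop :=
  (∀ x, (T x).Derives x.strengthened (.or x.α₀ x.α₁)) ∧
    SolvableInPolyTime Instance.IsCode Derivation.IsCode (fun x e => e = T x)

/-- The pair of an index `i` and a cut-deduction is a solution for `x`, relative to the derivation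
`e`: it is a cut-deduction of a subsequent of `Γ(k) ⇒ αᵢ` from the sequents occurring in `e`. -/
def Instance.IsSolution (x : Instance) (e : Derivation) (y : Bool × CutDeduction) : Prop :=
  y.2.CorrectFrom e.sequents ∧ y.2.concl.ant ⊆ x.strengthened ∧
    y.2.concl.succ = if y.1 then x.α₁ else x.α₀

/-- Codes of a pair of an index and a cut-deduction. -/
def solutionIsCode (y : Bool × CutDeduction) (w : Tree) : Prop :=
  ∃ a, y.2.IsCode a ∧ w = .node (.ofBool y.1) a

end IPC

namespace IPC

/-! ### Programs whose cost is polynomially bounded -/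

/-! For the transformation, γ(k) implies γ by induction on γ: ∨-introduction from the chosen
disjunct, componentwise under ∧, in the consequent under ⊃ (`derives_expand`). Weaken d by Γ(k),
then cut out every γ ∈ Γ with a strictly positive disjunction, the cut being simulated by
⊃-introduction and ⊃-elimination. The remaining formulas of Γ are their own γ(k), so the antecedent
left over is Γ(k) (`Instance.derives_transform`).

For the disjunction property, all that matters about d(k) is that it derives Γ(k) ⇒ α₀ ∨ α₁ and that
Γ(k) consists of Harrop formulas, those without strictly positive disjunctions. Let D be the set of
formulas reached from Γ(k) by forward chaining with the sequents of d(k). `Formula.Realized` is a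
variant of the Kleene–Aczel slash in which provability is replaced by membership in D. Harrop
formulas are realized for free, and the inferences of d(k) preserve realizability because D is
closed under the sequents of d(k) (`Derivation.Correct.realized`). Hence α₀ ∨ α₁ is realized, which
says that some αᵢ lies in D. Cutting along the firing order, backwards from αᵢ, gives a
cut-deduction with at most one cut per fired entry (`Chain.cutDeducible_foldr`).

The complexity bounds rest on one scheme, `PolyTime.recursion`: two recursive calls whose measures
add up to less than the measure of the argument, a potential that does not grow, and values known in
advance to have polynomial size. Folds over lists, recursion on formulas and recursion on derivation
codes are instances of it. The sizes of values are controlled by additive increments, since repeated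
composition of polynomial bounds could explode. -/

theorem Tree.size_pos (x : Tree) : 0 < x.size := by
  cases x <;> simp [Tree.size]

/-- Every step pays for the size of the tree it is applied to, and builds at most one new node. A
cost bound is therefore also an output bound, which is what makes polynomial cost closed under
composition. -/
theorem Runs.size_le {b p : Prog} {x y : Tree} {t : ℕ} (h : Runs b p x y t) : y.size ≤ t := by
  induction h with
  | eqNode b l r =>
    have := l.size_pos
    have := r.size_pos
    split <;> simp only [Tree.size] <;> omega
  | _ => (try simp only [Tree.size] at *); omega

/-- Types whose elements are coded by trees. -/
class Coded (α : Type) where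
  enc : α → Tree
  enc_injective : Function.Injective enc

open Coded (enc enc_injective)

theorem Tree.ofList_injective : Function.Injective Tree.ofList := by
  intro l
  induction l with
  | nil => intro l' h; cases l' <;> simp_all [Tree.ofList]
  | cons a l ih =>
    intro l' h
    cases l' with
    | nil => simp [Tree.ofList] at h
    | cons a' l' =>
      simp only [Tree.ofList, Tree.node.injEq] at h
      rw [h.1, ih h.2]

instance : Coded Tree := ⟨fun t => t, fun _ _ h => h⟩

instance {α β : Type} [Coded α] [Coded β] : Coded (α × β) where
  enc p := .node (enc p.1) (enc p.2)
  enc_injective p q h := by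
    simp only [Tree.node.injEq] at h
    exact Prod.ext (enc_injective h.1) (enc_injective h.2)

instance {α : Type} [Coded α] : Coded (List α) where
  enc l := .ofList (l.map enc)
  enc_injective := Tree.ofList_injective.comp (List.map_injective_iff.2 enc_injective)

instance : Coded Bool where
  enc := Tree.ofBool
  enc_injective a b h := by cases a <;> cases b <;> simp_all [Tree.ofBool]

section

variable {α β γ δ ε σ τ : Type} [Coded α] [Coded β] [Coded γ] [Coded δ] [Coded ε] [Coded σ]
  [Coded τ]

/-- The size of the code. -/
def csize (x : α) : ℕ := (enc x).size

theorem csize_pos (x : α) : 0 < csize x := Tree.size_pos _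

@[simp] theorem csize_tree (t : Tree) : csize t = t.size := rfl

@[simp] theorem csize_pair (x : α) (y : β) : csize (x, y) = csize x + csize y + 1 := rfl

@[simp] theorem csize_nil : csize ([] : List α) = 1 := rfl

@[simp] theorem csize_cons (x : α) (l : List α) : csize (x :: l) = csize x + csize l + 1 := rfl

theorem csize_bool_le (x : Bool) : csize x ≤ 3 := by cases x <;> decide

theorem csize_append (l l' : List α) : csize (l ++ l') + 1 = csize l + csize l' := by
  induction l with
  | nil => simp [Nat.add_comm]
  | cons a l ih => simp; omega

theorem csize_le_of_mem {x : α} {l : List α} (h : x ∈ l) : csize x < csize l := by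
  induction l with
  | nil => simp at h
  | cons a l ih =>
    rcases List.mem_cons.1 h with rfl | h
    · simp
    · have := ih h; simp; omega

theorem length_le_csize (l : List α) : 2 * l.length + 1 ≤ csize l := by
  induction l with
  | nil => simp
  | cons a l ih => have := csize_pos a; simp; omega

theorem csize_le_of_sublist {l l' : List α} (h : l.Sublist l') : csize l ≤ csize l' := by
  induction h with
  | slnil => simp
  | cons a _ ih => simp; omega
  | cons_cons a _ ih => simp; omega

theorem Polynomial.eval_mono_nat (P : Polynomial ℕ) {m n : ℕ} (h : m ≤ n) :
    P.eval m ≤ P.eval n := by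
  rw [Polynomial.eval_eq_sum, Polynomial.eval_eq_sum]
  exact Finset.sum_le_sum fun i _ => by
    exact Nat.mul_le_mul_left _ (Nat.pow_le_pow_left h i)

/-- The function `f` is computed, at a polynomial cost, by a program that does not call the
procedure in which it stands. -/
@[fun_prop]
def PolyTime (f : α → β) : Prop :=
  ∃ (p : Prog) (B : Polynomial ℕ), ∀ (b : Prog) (x : α), ∃ t,
    Runs b p (enc x) (enc (f x)) t ∧ t ≤ B.eval (csize x)

theorem PolyTime.csize_le {f : α → β} (hf : PolyTime f) :
    ∃ Q : Polynomial ℕ, ∀ x, csize (f x) ≤ Q.eval (csize x) := by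
  obtain ⟨p, B, h⟩ := hf
  refine ⟨B, fun x => ?_⟩
  obtain ⟨t, h₁, h₂⟩ := h .nil x
  exact h₁.size_le.trans h₂

/-- A program sees only codes, so functions that agree on codes share their program and their bound.
Constructors and projections of coded types thus reduce to operations on trees. -/
theorem PolyTime.of_enc {f : α → β} {g : γ → δ} (hg : PolyTime g)
    (h : ∀ x, ∃ y, enc y = enc x ∧ enc (g y) = enc (f x)) : PolyTime f := by
  obtain ⟨p, B, hp⟩ := hg
  refine ⟨p, B, fun b x => ?_⟩
  obtain ⟨y, h₁, h₂⟩ := h x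
  obtain ⟨t, h₃, h₄⟩ := hp b y
  rw [h₁, h₂] at h₃
  refine ⟨t, h₃, ?_⟩
  rwa [csize, h₁] at h₄

theorem PolyTime.of_tree {f : α → β} {g : Tree → Tree} (hg : PolyTime g)
    (h : ∀ x, g (enc x) = enc (f x)) : PolyTime f :=
  hg.of_enc fun x => ⟨enc x, rfl, h x⟩

@[fun_prop]
theorem PolyTime.id' : PolyTime (fun x : α => x) :=
  ⟨.id, .X + 1, fun b x => ⟨_, .id b _, by simp [csize]⟩⟩

/-- A program with a constant value. -/
def Prog.const : Tree → Prog
  | .nil => .nil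
  | .node l r => .cons (.const l) (.const r)

@[fun_prop]
theorem PolyTime.const (y : β) : PolyTime (fun _ : α => y) := by
  suffices h : ∀ y : Tree, ∃ B : Polynomial ℕ, ∀ b x, ∃ t, Runs b (.const y) x y t ∧
      t ≤ B.eval x.size by
    obtain ⟨B, h⟩ := h (enc y)
    exact ⟨_, B, fun b x => h b _⟩
  intro y
  induction y with
  | nil => exact ⟨.X + 1, fun b x => ⟨_, .nil b x, by simp⟩⟩
  | node l r ihl ihr =>
    obtain ⟨B₁, h₁⟩ := ihl
    obtain ⟨B₂, h₂⟩ := ihr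
    refine ⟨B₁ + B₂ + (.X + 1), fun b x => ?_⟩
    obtain ⟨s, hs, hs'⟩ := h₁ b x
    obtain ⟨t, ht, ht'⟩ := h₂ b x
    exact ⟨_, .cons hs ht, by simp; omega⟩

@[fun_prop]
theorem PolyTime.comp' {g : β → γ} {f : α → β} (hg : PolyTime g) (hf : PolyTime f) :
    PolyTime (fun x => g (f x)) := by
  obtain ⟨Q, hQ⟩ := hf.csize_le
  obtain ⟨p, B, hp⟩ := hf
  obtain ⟨q, C, hq⟩ := hg
  refine ⟨.comp q p, B + C.comp Q + (.X + 1), fun b x => ?_⟩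
  obtain ⟨s, hs, hs'⟩ := hp b x
  obtain ⟨t, ht, ht'⟩ := hq b (f x)
  refine ⟨_, .comp hs ht, ?_⟩
  have := ht'.trans (Polynomial.eval_mono_nat C (hQ x))
  simp [csize] at *
  omega

/-- Composition along a coding of the intermediate value by elements of two types. -/
theorem PolyTime.comp_enc {g : γ → δ} {f : α → β} (hg : PolyTime g) (hf : PolyTime f) :
    ∃ (p : Prog) (B : Polynomial ℕ), ∀ (b : Prog) (x : α) (y : γ), enc (f x) = enc y → ∃ t,
      Runs b p (enc x) (enc (g y)) t ∧ t ≤ B.eval (csize x) := by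
  obtain ⟨Q, hQ⟩ := hf.csize_le
  obtain ⟨p, B, hp⟩ := hf
  obtain ⟨q, C, hq⟩ := hg
  refine ⟨.comp q p, B + C.comp Q + (.X + 1), fun b x y h => ?_⟩
  obtain ⟨s, hs, hs'⟩ := hp b x
  obtain ⟨t, ht, ht'⟩ := hq b y
  rw [h] at hs
  refine ⟨_, .comp hs ht, ?_⟩
  have h' : csize y = csize (f x) := by rw [csize, ← h, csize]
  have := ht'.trans (Polynomial.eval_mono_nat C (h' ▸ hQ x))
  simp [csize] at *
  omega

@[fun_prop]
theorem PolyTime.prodMk {f : α → β} {g : α → γ} (hf : PolyTime f) (hg : PolyTime g) :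
    PolyTime (fun x => (f x, g x)) := by
  obtain ⟨p, B, hp⟩ := hf
  obtain ⟨q, C, hq⟩ := hg
  refine ⟨.cons p q, B + C + (.X + 1), fun b x => ?_⟩
  obtain ⟨s, hs, hs'⟩ := hp b x
  obtain ⟨t, ht, ht'⟩ := hq b x
  exact ⟨_, .cons hs ht, by simp [csize] at *; omega⟩

/-- The left subtree. -/
def Tree.lft : Tree → Tree
  | .nil => .nil
  | .node l _ => l

/-- The right subtree. -/
def Tree.rgt : Tree → Tree
  | .nil => .nil
  | .node _ r => r

theorem PolyTime.lft_aux : PolyTime Tree.lft := by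
  refine ⟨.left, .X + 1, fun b x => ?_⟩
  cases x
  · exact ⟨_, .leftNil b, by simp [Tree.size]⟩
  · exact ⟨_, .leftNode b _ _, by simp⟩

theorem PolyTime.rgt_aux : PolyTime Tree.rgt := by
  refine ⟨.right, .X + 1, fun b x => ?_⟩
  cases x
  · exact ⟨_, .rightNil b, by simp [Tree.size]⟩
  · exact ⟨_, .rightNode b _ _, by simp⟩

@[fun_prop]
theorem PolyTime.lft {f : α → Tree} (hf : PolyTime f) : PolyTime (fun x => (f x).lft) :=
  lft_aux.comp' hf

@[fun_prop]
theorem PolyTime.rgt {f : α → Tree} (hf : PolyTime f) : PolyTime (fun x => (f x).rgt) :=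
  rgt_aux.comp' hf

@[fun_prop]
theorem PolyTime.fst' {f : α → β × γ} (hf : PolyTime f) : PolyTime (fun x => (f x).1) :=
  comp' (lft_aux.of_tree (f := Prod.fst) fun _ => rfl) hf

@[fun_prop]
theorem PolyTime.snd' {f : α → β × γ} (hf : PolyTime f) : PolyTime (fun x => (f x).2) :=
  comp' (rgt_aux.of_tree (f := Prod.snd) fun _ => rfl) hf

@[fun_prop]
theorem PolyTime.node {f g : α → Tree} (hf : PolyTime f) (hg : PolyTime g) :
    PolyTime (fun x => Tree.node (f x) (g x)) :=
  (hf.prodMk hg).of_enc fun x => ⟨x, rfl, rfl⟩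

@[fun_prop]
theorem PolyTime.enc' {f : α → β} (hf : PolyTime f) : PolyTime (fun x => enc (f x)) :=
  hf.of_enc fun x => ⟨x, rfl, rfl⟩

/-- Equality as a truth value. -/
def eqb (x y : α) : Bool := decide (enc x = enc y)

@[simp]
theorem eqb_iff {x y : α} : eqb x y = true ↔ x = y := by
  simp [eqb, (enc_injective (α := α)).eq_iff]

@[fun_prop]
theorem PolyTime.eqb {f g : α → β} (hf : PolyTime f) (hg : PolyTime g) :
    PolyTime (fun x => eqb (f x) (g x)) := by
  refine comp' (g := fun p : β × β => IPC.eqb p.1 p.2) ?_ (hf.prodMk hg)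
  refine ⟨.eq, .X + 1, fun b p => ?_⟩
  refine ⟨_, (?_ : Runs b .eq _ _ ((enc p).size + 1)), by simp [csize]⟩
  obtain ⟨x, y⟩ := p
  have := Runs.eqNode b (enc x) (enc y)
  change Runs b .eq (.node (enc x) (enc y)) (Tree.ofBool (decide (enc x = enc y))) _
  by_cases h : enc x = enc y
  · rw [if_pos h] at this
    rw [decide_eq_true h]
    exact this
  · rw [if_neg h] at this
    rw [decide_eq_false h]
    exact this

@[fun_prop]
theorem PolyTime.cond {c : α → Bool} {f g : α → β} (hc : PolyTime c) (hf : PolyTime f)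
    (hg : PolyTime g) : PolyTime (fun x => cond (c x) (f x) (g x)) := by
  obtain ⟨r, A, hr⟩ := hc
  obtain ⟨p, B, hp⟩ := hf
  obtain ⟨q, C, hq⟩ := hg
  refine ⟨.ite r p q, A + B + C + (.X + 1), fun b x => ?_⟩
  obtain ⟨u, hu, hu'⟩ := hr b x
  obtain ⟨s, hs, hs'⟩ := hp b x
  obtain ⟨t, ht, ht'⟩ := hq b x
  cases h : c x <;> rw [h] at hu
  · exact ⟨_, by simpa [h] using Runs.iteNil hu ht, by simp [csize] at *; omega⟩
  · exact ⟨_, by simpa [h] using Runs.iteNode hu hs, by simp [csize] at *; omega⟩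

@[fun_prop]
theorem PolyTime.and {c d : α → Bool} (hc : PolyTime c) (hd : PolyTime d) :
    PolyTime (fun x => (c x && d x)) := by
  have : PolyTime (fun x => bif c x then d x else false) := by fun_prop
  convert this using 2 with x
  cases c x <;> rfl

@[fun_prop]
theorem PolyTime.or {c d : α → Bool} (hc : PolyTime c) (hd : PolyTime d) :
    PolyTime (fun x => (c x || d x)) := by
  have : PolyTime (fun x => bif c x then true else d x) := by fun_prop
  convert this using 2 with x
  cases c x <;> rfl

@[fun_prop]
theorem PolyTime.not {c : α → Bool} (hc : PolyTime c) : PolyTime (fun x => !c x) := by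
  have : PolyTime (fun x => bif c x then false else true) := by fun_prop
  convert this using 2 with x
  cases c x <;> rfl

/-! ### Recursion -/

/-- Recursion with two calls, bounded by the additive measure `m` and the potential `Φ`. -/
theorem PolyTime.recursion {F : α → β} {base : α → Bool} {h : α → β} {g₁ g₂ : α → α}
    {c : α × β × β → β} (hbase : PolyTime base) (hh : PolyTime h) (hg₁ : PolyTime g₁)
    (hg₂ : PolyTime g₂) (hc : PolyTime c)
    (F_base : ∀ x, base x = true → F x = h x)
    (F_rec : ∀ x, base x = false → F x = c (x, F (g₁ x), F (g₂ x)))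
    (m Φ : α → ℕ) (m_pos : ∀ x, 0 < m x)
    (m_add : ∀ x, base x = false → m (g₁ x) + m (g₂ x) < m x)
    (m_le : ∀ x, m x ≤ Φ x) (csize_le_Φ : ∀ x, csize x ≤ Φ x)
    (Φ₁ : ∀ x, base x = false → Φ (g₁ x) ≤ Φ x) (Φ₂ : ∀ x, base x = false → Φ (g₂ x) ≤ Φ x)
    (Φ_le : ∃ P : Polynomial ℕ, ∀ x, Φ x ≤ P.eval (csize x))
    (F_le : ∃ P : Polynomial ℕ, ∀ x, csize (F x) ≤ P.eval (Φ x)) : PolyTime F := by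
  obtain ⟨P, hP⟩ := Φ_le
  obtain ⟨R, hR⟩ := F_le
  obtain ⟨pb, Bb, hb⟩ := hbase
  obtain ⟨ph, Bh, hh⟩ := hh
  obtain ⟨p₁, B₁, h₁⟩ := hg₁
  obtain ⟨p₂, B₂, h₂⟩ := hg₂
  obtain ⟨pc, Bc, hc⟩ := hc
  let body : Prog := .ite pb ph (.comp pc (.cons .id (.cons (.comp .call p₁) (.comp .call p₂))))
  -- `C` bounds one activation of `body` without its recursive calls. The body has nine program
  -- nodes besides the given subprograms, whence the factor 9; the argument of `Bc` is the size of
  -- the triple passed to `pc`, whose two pairings add 2.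
  let C : Polynomial ℕ := Bb + Bh + B₁ + B₂ + Bc.comp (.X + R + R + 2) + 9 * (.X + 1)
  -- Since the measures of the two calls add up to less than `m x`, there are at most `m x`
  -- activations; each costs at most `C` at the potential of the root, which bounds all later
  -- potentials.
  have key : ∀ N x, m x ≤ N → ∃ t, Runs body body (enc x) (enc (F x)) t ∧
      t ≤ m x * C.eval (Φ x) := by
    intro N
    induction N with
    | zero => intro x hx; have := m_pos x; omega
    | succ N ih =>
      intro x hx
      obtain ⟨tb, rb, lb⟩ := hb body x
      have lb' := lb.trans (Polynomial.eval_mono_nat Bb (csize_le_Φ x))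
      have hx' := csize_le_Φ x
      have hC : C.eval (Φ x) = Bb.eval (Φ x) + Bh.eval (Φ x) + B₁.eval (Φ x) + B₂.eval (Φ x) +
          Bc.eval (Φ x + R.eval (Φ x) + R.eval (Φ x) + 2) + 9 * (Φ x + 1) := by
        simp [C]
      cases hbx : base x with
      | true =>
        rw [hbx] at rb
        obtain ⟨th, rh, lh⟩ := hh body x
        have lh' := lh.trans (Polynomial.eval_mono_nat Bh (csize_le_Φ x))
        rw [F_base x hbx]
        refine ⟨_, .iteNode rb rh, ?_⟩
        calc _ ≤ C.eval (Φ x) := by rw [hC]; simp only [csize] at *; omega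
          _ ≤ _ := Nat.le_mul_of_pos_left _ (m_pos x)
      | false =>
        rw [hbx] at rb
        have hm := m_add x hbx
        obtain ⟨s₁, q₁, l₁⟩ := h₁ body x
        obtain ⟨s₂, q₂, l₂⟩ := h₂ body x
        have l₁' := l₁.trans (Polynomial.eval_mono_nat B₁ (csize_le_Φ x))
        have l₂' := l₂.trans (Polynomial.eval_mono_nat B₂ (csize_le_Φ x))
        obtain ⟨t₁, r₁, k₁⟩ := ih (g₁ x) (by omega)
        obtain ⟨t₂, r₂, k₂⟩ := ih (g₂ x) (by omega)
        have k₁' := k₁.trans (Nat.mul_le_mul_left _ (Polynomial.eval_mono_nat C (Φ₁ x hbx)))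
        have k₂' := k₂.trans (Nat.mul_le_mul_left _ (Polynomial.eval_mono_nat C (Φ₂ x hbx)))
        have e₁ := (hR (g₁ x)).trans (Polynomial.eval_mono_nat R (Φ₁ x hbx))
        have e₂ := (hR (g₂ x)).trans (Polynomial.eval_mono_nat R (Φ₂ x hbx))
        have z₁ := (csize_le_Φ (g₁ x)).trans (Φ₁ x hbx)
        have z₂ := (csize_le_Φ (g₂ x)).trans (Φ₂ x hbx)
        obtain ⟨tc, rc, lc⟩ := hc body (x, F (g₁ x), F (g₂ x))
        have lc' : tc ≤ Bc.eval (Φ x + R.eval (Φ x) + R.eval (Φ x) + 2) :=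
          lc.trans (Polynomial.eval_mono_nat Bc (by simp; omega))
        rw [F_rec x hbx]
        refine ⟨_, .iteNil rb (.comp (.cons (.id _ _) (.cons (.comp q₁ (.call r₁))
          (.comp q₂ (.call r₂)))) rc), ?_⟩
        calc _ ≤ C.eval (Φ x) + (m (g₁ x) * C.eval (Φ x) + m (g₂ x) * C.eval (Φ x)) := by
              rw [hC] at *; simp only [csize] at *; omega
          _ = (m (g₁ x) + m (g₂ x) + 1) * C.eval (Φ x) := by ring
          _ ≤ _ := Nat.mul_le_mul_right _ hm
  refine ⟨.mu body, P * C.comp P + (.X + 1), fun b x => ?_⟩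
  obtain ⟨t, ht, ht'⟩ := key _ x le_rfl
  refine ⟨_, .mu ht, ?_⟩
  have : m x * C.eval (Φ x) ≤ P.eval (csize x) * C.eval (P.eval (csize x)) :=
    Nat.mul_le_mul ((m_le x).trans (hP x)) (Polynomial.eval_mono_nat C (hP x))
  simp [csize] at *
  omega

omit [Coded α] in
/-- A bound for the values of a recursive function the sizes of which add up. -/
theorem csize_le_of_additive {F : α → β} {base : α → Bool} {g₁ g₂ : α → α} (m Φ : α → ℕ)
    (m_pos : ∀ x, 0 < m x) (m_add : ∀ x, base x = false → m (g₁ x) + m (g₂ x) < m x)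
    (m_le : ∀ x, m x ≤ Φ x)
    (Φ₁ : ∀ x, base x = false → Φ (g₁ x) ≤ Φ x) (Φ₂ : ∀ x, base x = false → Φ (g₂ x) ≤ Φ x)
    (Q : Polynomial ℕ) (F_base : ∀ x, base x = true → csize (F x) ≤ Q.eval (Φ x))
    (F_rec : ∀ x, base x = false →
      csize (F x) ≤ csize (F (g₁ x)) + csize (F (g₂ x)) + Q.eval (Φ x)) :
    ∃ P : Polynomial ℕ, ∀ x, csize (F x) ≤ P.eval (Φ x) := by
  have key : ∀ N x, m x ≤ N → csize (F x) ≤ m x * Q.eval (Φ x) := by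
    intro N
    induction N with
    | zero => intro x hx; have := m_pos x; omega
    | succ N ih =>
      intro x hx
      cases hb : base x with
      | true => exact (F_base x hb).trans (Nat.le_mul_of_pos_left _ (m_pos x))
      | false =>
        have hm := m_add x hb
        have k₁ := (ih (g₁ x) (by omega)).trans
          (Nat.mul_le_mul_left _ (Polynomial.eval_mono_nat Q (Φ₁ x hb)))
        have k₂ := (ih (g₂ x) (by omega)).trans
          (Nat.mul_le_mul_left _ (Polynomial.eval_mono_nat Q (Φ₂ x hb)))
        calc _ ≤ _ := F_rec x hb
          _ ≤ (m (g₁ x) + m (g₂ x) + 1) * Q.eval (Φ x) := by linarith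
          _ ≤ _ := Nat.mul_le_mul_right _ hm
  refine ⟨.X * Q, fun x => (key _ x le_rfl).trans ?_⟩
  simpa using Nat.mul_le_mul_right _ (m_le x)

/-! ### Lists -/

@[fun_prop]
theorem PolyTime.cons {f : α → β} {g : α → List β} (hf : PolyTime f) (hg : PolyTime g) :
    PolyTime (fun x => f x :: g x) :=
  (hf.prodMk hg).of_enc fun x => ⟨x, rfl, rfl⟩

@[fun_prop]
theorem PolyTime.tail {f : α → List β} (hf : PolyTime f) : PolyTime (fun x => (f x).tail) :=
  comp' (rgt_aux.of_tree (f := List.tail) fun l => by cases l <;> rfl) hf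

@[fun_prop]
theorem PolyTime.isEmpty {f : α → List β} (hf : PolyTime f) :
    PolyTime (fun x => (f x).isEmpty) := by
  have : PolyTime (fun x => IPC.eqb (f x) []) := by fun_prop
  convert this using 2 with x
  rw [Bool.eq_iff_iff]
  simp

@[fun_prop]
theorem PolyTime.headD {f : α → List β} {g : α → β} (hf : PolyTime f) (hg : PolyTime g) :
    PolyTime (fun x => (f x).headD (g x)) := by
  have : PolyTime (fun x => bif (f x).isEmpty then enc (g x) else (enc (f x)).lft) := by fun_prop
  refine this.of_enc fun x => ⟨x, rfl, ?_⟩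
  cases f x <;> rfl

/-- A fold is a two-call recursion whose second call goes to the empty list and is ignored. -/
theorem PolyTime.foldr_of_le {f : ε → τ → β → β} {h : ε → β} {l : ε → List τ}
    (hf : PolyTime (fun p : ε × τ × β => f p.1 p.2.1 p.2.2)) (hh : PolyTime h) (hl : PolyTime l)
    (le : ∃ P : Polynomial ℕ, ∀ e (l : List τ), csize (l.foldr (f e) (h e)) ≤ P.eval (csize (e, l))) :
    PolyTime (fun e => (l e).foldr (f e) (h e)) := by
  refine comp' (g := fun p : ε × List τ => p.2.foldr (f p.1) (h p.1)) ?_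
    (f := fun e => (e, l e)) (by fun_prop)
  obtain ⟨P, hP⟩ := le
  -- The type `τ` may have no element to serve as a default head, so the head is read off the code
  -- of the list. The value on the empty list is arbitrary.
  have head : PolyTime (fun q : (ε × List τ) × β × β =>
      if h : q.1.2 = [] then q.2.1 else f q.1.1 (q.1.2.head h) q.2.1) := by
    obtain ⟨p, B, hp⟩ := hf
    have : PolyTime (fun q : (ε × List τ) × β × β =>
        (enc q.1.1, (enc q.1.2).lft, enc q.2.1)) := by fun_prop
    obtain ⟨r, A, hr⟩ := this
    obtain ⟨Q, hQ⟩ := PolyTime.csize_le (⟨r, A, hr⟩ : PolyTime (fun q : (ε × List τ) × β × β =>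
        (enc q.1.1, (enc q.1.2).lft, enc q.2.1)))
    have := (PolyTime.isEmpty (α := (ε × List τ) × β × β) (f := fun q => q.1.2) (by fun_prop))
    obtain ⟨s, C, hs⟩ := this
    have := (PolyTime.fst' (PolyTime.snd' (PolyTime.id' (α := (ε × List τ) × β × β))))
    obtain ⟨u, D, hu⟩ := this
    refine ⟨.ite s u (.comp p r), C + D + A + B.comp Q + 2 * (.X + 1), fun b q => ?_⟩
    obtain ⟨⟨e, l⟩, y, z⟩ := q
    obtain ⟨t₁, a₁, b₁⟩ := hs b ((e, l), y, z)
    cases l with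
    | nil =>
      obtain ⟨t₂, a₂, b₂⟩ := hu b ((e, []), y, z)
      exact ⟨_, .iteNode a₁ a₂, by simp [csize] at *; omega⟩
    | cons a l =>
      obtain ⟨t₂, a₂, b₂⟩ := hr b ((e, a :: l), y, z)
      obtain ⟨t₃, a₃, b₃⟩ := hp b (e, a, y)
      have := b₃.trans (Polynomial.eval_mono_nat B (hQ ((e, a :: l), y, z)))
      exact ⟨_, .iteNil a₁ (.comp a₂ a₃), by simp [csize] at *; omega⟩
  -- The dummy call has measure 1, so the plain length would not do: with 2 * length + 1 the two
  -- calls add up to 2 * length.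
  refine PolyTime.recursion (base := fun p => p.2.isEmpty) (h := fun p => h p.1)
    (g₁ := fun p => (p.1, p.2.tail)) (g₂ := fun p => (p.1, [])) (by fun_prop) (by fun_prop)
    (by fun_prop) (by fun_prop) head ?_ ?_ (fun p => 2 * p.2.length + 1) csize ?_ ?_ ?_
    (fun _ => le_rfl) ?_ ?_ ⟨.X, fun x => by simp⟩ ⟨P, fun p => hP p.1 p.2⟩
  · rintro ⟨e, l⟩ h; simp_all
  · rintro ⟨e, l⟩ h; cases l <;> simp_all
  · intro; omega
  · rintro ⟨e, l⟩ h; cases l <;> simp_all; omega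
  · rintro ⟨e, l⟩; have := length_le_csize l; simp; omega
  · rintro ⟨e, l⟩ h; cases l <;> simp_all; omega
  · rintro ⟨e, l⟩ h; cases l <;> simp_all

omit [Coded β] [Coded τ] in
theorem foldr_le {f : τ → β → β} {b : β} {l : List τ} (w : β → ℕ) (q : ℕ)
    (h : ∀ x ∈ l, ∀ y, w (f x y) ≤ w y + q) : w (l.foldr f b) ≤ w b + l.length * q := by
  induction l with
  | nil => simp
  | cons a l ih =>
    have h₁ := h a (by simp) (l.foldr f b)
    have h₂ := ih fun x hx => h x (by simp [hx])
    simp only [List.foldr_cons, List.length_cons]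
    linarith

/-- The increment depends on the parameter and the list element but not on the accumulator, so the
growth over the whole fold is at most the length times one polynomial. -/
theorem PolyTime.foldr {f : ε → τ → β → β} {h : ε → β} {l : ε → List τ}
    (hf : PolyTime (fun p : ε × τ × β => f p.1 p.2.1 p.2.2)) (hh : PolyTime h) (hl : PolyTime l)
    (le : ∃ Q : Polynomial ℕ, ∀ e x y, csize (f e x y) ≤ csize y + Q.eval (csize (e, x))) :
    PolyTime (fun e => (l e).foldr (f e) (h e)) := by
  refine foldr_of_le hf hh hl ?_
  obtain ⟨Q, hQ⟩ := le
  obtain ⟨H, hH⟩ := hh.csize_le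
  refine ⟨H + .X * Q, fun e l => ?_⟩
  have h₁ := foldr_le (f := f e) (b := h e) (l := l) csize (Q.eval (csize (e, l)))
    fun x hx y => (hQ e x y).trans (by
      gcongr
      apply Polynomial.eval_mono_nat
      have := csize_le_of_mem hx
      simp; omega)
  have h₂ := (hH e).trans (Polynomial.eval_mono_nat H (show csize e ≤ csize (e, l) by simp; omega))
  have h₃ : l.length * Q.eval (csize (e, l)) ≤ csize (e, l) * Q.eval (csize (e, l)) := by
    gcongr
    have := length_le_csize l
    simp; omega
  simp only [Polynomial.eval_add, Polynomial.eval_mul, Polynomial.eval_X]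
  omega

/-- A fold with a pair of accumulators, the second of which grows by an amount that depends on the
first one. -/
theorem PolyTime.foldr_pair {f : ε → τ → β × γ → β × γ} {h : ε → β × γ} {l : ε → List τ}
    (hf : PolyTime (fun p : ε × τ × β × γ => f p.1 p.2.1 p.2.2)) (hh : PolyTime h)
    (hl : PolyTime l)
    (le₁ : ∃ Q : Polynomial ℕ, ∀ e x y, csize (f e x y).1 ≤ csize y.1 + Q.eval (csize (e, x)))
    (le₂ : ∃ Q : Polynomial ℕ, ∀ e x y,
      csize (f e x y).2 ≤ csize y.2 + Q.eval (csize (e, x, y.1))) :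
    PolyTime (fun e => (l e).foldr (f e) (h e)) := by
  refine foldr_of_le hf hh hl ?_
  obtain ⟨Q, hQ⟩ := le₁
  obtain ⟨R, hR⟩ := le₂
  obtain ⟨H, hH⟩ := hh.csize_le
  refine ⟨(H + .X * Q) + (H + .X * R.comp (.X + 1 + (H + .X * Q))) + 1, fun e l => ?_⟩
  have hh' := (hH e).trans (Polynomial.eval_mono_nat H (show csize e ≤ csize (e, l) by simp; omega))
  generalize hn : csize (e, l) = n at *
  have hlen : l.length ≤ n := by
    have := length_le_csize l
    simp at hn; omega
  have hmem : ∀ x ∈ l, csize (e, x) ≤ n := fun x hx => by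
    have := csize_le_of_mem hx
    simp at hn ⊢; omega
  clear hn
  have e₀ : csize (h e) = csize (h e).1 + csize (h e).2 + 1 := rfl
  -- Induction over suffixes of the fixed list keeps every element and every length below the same
  -- `n`. The bound on the first accumulator feeds the increment of the second.
  have key : ∀ l' : List τ, l' <:+ l → csize (l'.foldr (f e) (h e)).1 ≤
      H.eval n + l'.length * Q.eval n ∧ csize (l'.foldr (f e) (h e)).2 ≤
      H.eval n + l'.length * R.eval (n + 1 + (H.eval n + n * Q.eval n)) := by
    intro l'
    induction l' with
    | nil => intro _; simp only [List.foldr_nil, List.length_nil]; omega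
    | cons x l' ih =>
      intro hs
      have hx := hmem x (hs.subset (by simp))
      obtain ⟨i₁, i₂⟩ := ih ((List.suffix_cons x l').trans hs)
      have hl' : l'.length ≤ n := by have := hs.length_le; simp at this; omega
      have j₁ := (hQ e x (l'.foldr (f e) (h e))).trans
        (Nat.add_le_add_left (Polynomial.eval_mono_nat Q hx) _)
      have j₂ := (hR e x (l'.foldr (f e) (h e))).trans
        (Nat.add_le_add_left (Polynomial.eval_mono_nat R
          (show _ ≤ n + 1 + (H.eval n + n * Q.eval n) by
            have := Nat.mul_le_mul_right (Q.eval n) hl'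
            simp at hx ⊢; omega)) _)
      simp only [List.foldr_cons, List.length_cons, Nat.add_mul, one_mul]
      omega
  obtain ⟨k₁, k₂⟩ := key l List.suffix_rfl
  have := Nat.mul_le_mul_right (Q.eval n) hlen
  have := Nat.mul_le_mul_right (R.eval (n + 1 + (H.eval n + n * Q.eval n))) hlen
  have e₁ : csize (l.foldr (f e) (h e)) =
    csize (l.foldr (f e) (h e)).1 + csize (l.foldr (f e) (h e)).2 + 1 := rfl
  simp
  omega

@[fun_prop]
theorem PolyTime.append {f g : α → List β} (hf : PolyTime f) (hg : PolyTime g) :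
    PolyTime (fun x => f x ++ g x) := by
  have : PolyTime (fun x => (f x).foldr List.cons (g x)) :=
    PolyTime.foldr (by fun_prop) hg hf ⟨.X, fun e x y => by simp; omega⟩
  simpa using this

@[fun_prop]
theorem PolyTime.reverse {f : α → List β} (hf : PolyTime f) :
    PolyTime (fun x => (f x).reverse) := by
  have : PolyTime (fun x => (f x).foldr (fun a l => l ++ [a]) []) :=
    PolyTime.foldr (by fun_prop) (by fun_prop) hf
      ⟨.X, fun e x y => by have := csize_append y [x]; simp at *; omega⟩
  convert this using 2 with x
  induction f x <;> simp_all

@[fun_prop]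
theorem PolyTime.flatten {f : α → List (List β)} (hf : PolyTime f) :
    PolyTime (fun x => (f x).flatten) := by
  have : PolyTime (fun x => (f x).foldr (fun a l => a ++ l) []) :=
    PolyTime.foldr (by fun_prop) (by fun_prop) hf
      ⟨.X, fun e x y => by have := csize_append x y; simp; omega⟩
  convert this using 2 with x
  induction f x <;> simp_all

theorem PolyTime.map {f : ε → τ → β} {l : ε → List τ}
    (hf : PolyTime (fun p : ε × τ => f p.1 p.2)) (hl : PolyTime l) :
    PolyTime (fun e => (l e).map (f e)) := by
  have : PolyTime (fun e => (l e).foldr (fun x acc => f e x :: acc) []) := by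
    refine PolyTime.foldr ?_ (by fun_prop) hl ?_
    · exact PolyTime.cons (comp' hf (f := fun p : ε × τ × List β => (p.1, p.2.1)) (by fun_prop))
        (by fun_prop)
    · obtain ⟨Q, hQ⟩ := hf.csize_le
      exact ⟨Q + 1, fun e x y => by have := hQ (e, x); simp at *; omega⟩
  simpa using this

theorem PolyTime.filter {f : ε → τ → Bool} {l : ε → List τ}
    (hf : PolyTime (fun p : ε × τ => f p.1 p.2)) (hl : PolyTime l) :
    PolyTime (fun e => (l e).filter (f e)) := by
  have : PolyTime (fun e => (l e).foldr (fun x acc => bif f e x then x :: acc else acc) []) := by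
    refine PolyTime.foldr ?_ (by fun_prop) hl ?_
    · have := comp' hf (f := fun p : ε × τ × List τ => (p.1, p.2.1)) (by fun_prop)
      fun_prop
    · exact ⟨.X, fun e x y => by cases f e x <;> simp; omega⟩
  convert this using 2 with e
  induction l e with
  | nil => rfl
  | cons a l ih => cases h : f e a <;> simp [h, ih]

theorem PolyTime.all {f : ε → τ → Bool} {l : ε → List τ}
    (hf : PolyTime (fun p : ε × τ => f p.1 p.2)) (hl : PolyTime l) :
    PolyTime (fun e => (l e).all (f e)) := by
  have : PolyTime (fun e => (l e).foldr (fun x acc => f e x && acc) true) := by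
    refine PolyTime.foldr ?_ (by fun_prop) hl ?_
    · have := comp' hf (f := fun p : ε × τ × Bool => (p.1, p.2.1)) (by fun_prop)
      fun_prop
    · exact ⟨3, fun e x y => (csize_bool_le _).trans (by simp)⟩
  convert this using 2 with e
  induction l e with
  | nil => rfl
  | cons a l ih => simp [ih]

/-- Membership in a list as a truth value. -/
def memb (x : α) (l : List α) : Bool := !l.all fun y => !eqb x y

@[simp]
theorem memb_iff {x : α} {l : List α} : memb x l = true ↔ x ∈ l := by
  simp [memb]

@[fun_prop]
theorem PolyTime.memb {f : α → β} {l : α → List β} (hf : PolyTime f) (hl : PolyTime l) :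
    PolyTime (fun x => memb (f x) (l x)) := by
  have : PolyTime (fun x => (l x).all fun y => !IPC.eqb (f x) y) :=
    PolyTime.all (by fun_prop) hl
  exact this.not

end

/-! ### Operations on formulas -/

theorem Tree.ofNat_injective : Function.Injective Tree.ofNat := by
  intro m n h
  have h' : m.bits = n.bits := enc_injective (α := List Bool) h
  refine Nat.eq_of_testBit_eq fun i => ?_
  rw [Nat.testBit_eq_inth, Nat.testBit_eq_inth, h']

theorem Formula.code_injective : Function.Injective Formula.code := by
  intro φ
  induction φ with
  | var n =>
    intro ψ h
    cases ψ <;> simp_all [Formula.code, Tree.label, Tree.ofNat_injective.eq_iff]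
  | bot => intro ψ h; cases ψ <;> simp_all [Formula.code, Tree.label]
  | or a b iha ihb =>
    intro ψ h
    cases ψ <;> simp [Formula.code, Tree.label] at h ⊢
    exact ⟨iha h.1, ihb h.2⟩
  | and a b iha ihb =>
    intro ψ h
    cases ψ <;> simp [Formula.code, Tree.label] at h ⊢
    exact ⟨iha h.1, ihb h.2⟩
  | imp a b iha ihb =>
    intro ψ h
    cases ψ <;> simp [Formula.code, Tree.label] at h ⊢
    exact ⟨iha h.1, ihb h.2⟩

instance : Coded Formula := ⟨Formula.code, Formula.code_injective⟩

namespace Formula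

def isOr : Formula → Bool
  | .or _ _ => true
  | _ => false

def isAnd : Formula → Bool
  | .and _ _ => true
  | _ => false

def isImp : Formula → Bool
  | .imp _ _ => true
  | _ => false

def isPrime : Formula → Bool
  | .var _ => true
  | .bot => true
  | _ => false

/-- The left immediate subformula; a prime formula itself. -/
def fst : Formula → Formula
  | .or a _ => a
  | .and a _ => a
  | .imp a _ => a
  | φ => φ

/-- The right immediate subformula; a prime formula itself. -/
def snd : Formula → Formula
  | .or _ b => b
  | .and _ b => b
  | .imp _ b => b
  | φ => φ

end Formula

section

variable {α : Type} [Coded α]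

theorem csize_or (a b : Formula) : csize (Formula.or a b) = csize a + csize b + 7 := by
  simp only [csize, enc, Formula.code, Tree.size, Tree.label]; omega

theorem csize_and (a b : Formula) : csize (Formula.and a b) = csize a + csize b + 9 := by
  simp only [csize, enc, Formula.code, Tree.size, Tree.label]; omega

theorem csize_imp (a b : Formula) : csize (Formula.imp a b) = csize a + csize b + 11 := by
  simp only [csize, enc, Formula.code, Tree.size, Tree.label]; omega

/-- The constant is the least of those for the three connectives. This makes the code size a measure
for two-call recursion on formulas, with slack for growing positions. -/
theorem csize_fst_add_snd {φ : Formula} (h : φ.isPrime = false) :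
    csize φ.fst + csize φ.snd + 7 ≤ csize φ := by
  cases φ <;> simp_all [Formula.isPrime, Formula.fst, Formula.snd, csize_or, csize_and, csize_imp]

@[fun_prop]
theorem PolyTime.isOr {f : α → Formula} (hf : PolyTime f) : PolyTime (fun x => (f x).isOr) := by
  refine comp' (g := Formula.isOr) ?_ hf
  exact of_tree (g := fun t => enc (IPC.eqb t.lft (.label 2))) (by fun_prop) fun φ => by
    cases φ <;> rfl

@[fun_prop]
theorem PolyTime.isAnd {f : α → Formula} (hf : PolyTime f) : PolyTime (fun x => (f x).isAnd) := by
  refine comp' (g := Formula.isAnd) ?_ hf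
  exact of_tree (g := fun t => enc (IPC.eqb t.lft (.label 3))) (by fun_prop) fun φ => by
    cases φ <;> rfl

@[fun_prop]
theorem PolyTime.isImp {f : α → Formula} (hf : PolyTime f) : PolyTime (fun x => (f x).isImp) := by
  refine comp' (g := Formula.isImp) ?_ hf
  exact of_tree (g := fun t => enc (IPC.eqb t.lft (.label 4))) (by fun_prop) fun φ => by
    cases φ <;> rfl

@[fun_prop]
theorem PolyTime.isPrime {f : α → Formula} (hf : PolyTime f) :
    PolyTime (fun x => (f x).isPrime) := by
  have : PolyTime (fun x => !((f x).isOr || ((f x).isAnd || (f x).isImp))) := by fun_prop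
  convert this using 2 with x
  cases f x <;> rfl

@[fun_prop]
theorem PolyTime.formulaFst {f : α → Formula} (hf : PolyTime f) :
    PolyTime (fun x => (f x).fst) := by
  have : PolyTime fun x => bif (f x).isPrime then enc (f x) else (enc (f x)).rgt.lft := by fun_prop
  refine this.of_enc fun x => ⟨x, rfl, ?_⟩
  cases f x <;> rfl

@[fun_prop]
theorem PolyTime.formulaSnd {f : α → Formula} (hf : PolyTime f) :
    PolyTime (fun x => (f x).snd) := by
  have : PolyTime fun x => bif (f x).isPrime then enc (f x) else (enc (f x)).rgt.rgt := by fun_prop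
  refine this.of_enc fun x => ⟨x, rfl, ?_⟩
  cases f x <;> rfl

@[fun_prop]
theorem PolyTime.formulaOr {f g : α → Formula} (hf : PolyTime f) (hg : PolyTime g) :
    PolyTime (fun x => (f x).or (g x)) := by
  have : PolyTime fun x => Tree.node (.label 2) (.node (enc (f x)) (enc (g x))) := by fun_prop
  exact this.of_enc fun x => ⟨x, rfl, rfl⟩

@[fun_prop]
theorem PolyTime.formulaAnd {f g : α → Formula} (hf : PolyTime f) (hg : PolyTime g) :
    PolyTime (fun x => (f x).and (g x)) := by
  have : PolyTime fun x => Tree.node (.label 3) (.node (enc (f x)) (enc (g x))) := by fun_prop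
  exact this.of_enc fun x => ⟨x, rfl, rfl⟩

@[fun_prop]
theorem PolyTime.formulaImp {f g : α → Formula} (hf : PolyTime f) (hg : PolyTime g) :
    PolyTime (fun x => (f x).imp (g x)) := by
  have : PolyTime fun x => Tree.node (.label 4) (.node (enc (f x)) (enc (g x))) := by fun_prop
  exact this.of_enc fun x => ⟨x, rfl, rfl⟩

end

/-! ### Enumerating the strictly positive disjunctions -/

/-- The positions of the strictly positive disjunctions, larger ones first. -/
def Formula.disjPos : Formula → List Pos
  | .var _ => []
  | .bot => []
  | .or a b => [] :: (a.disjPos.map (false :: ·) ++ b.disjPos.map (true :: ·))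
  | .and a b => a.disjPos.map (false :: ·) ++ b.disjPos.map (true :: ·)
  | .imp _ b => b.disjPos.map (true :: ·)

theorem Formula.mem_disjPos {φ : Formula} {p : Pos} :
    p ∈ φ.disjPos ↔ ∃ β₀ β₁, SPos φ p (.or β₀ β₁) := by
  induction φ generalizing p with
  | var n => simp only [disjPos, List.not_mem_nil, false_iff]; rintro ⟨_, _, ⟨⟩⟩
  | bot => simp only [disjPos, List.not_mem_nil, false_iff]; rintro ⟨_, _, ⟨⟩⟩
  | or a b iha ihb =>
    simp only [disjPos, List.mem_cons, List.mem_append, List.mem_map, iha, ihb]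
    constructor
    · rintro (rfl | ⟨p, ⟨_, _, h⟩, rfl⟩ | ⟨p, ⟨_, _, h⟩, rfl⟩)
      · exact ⟨_, _, .here _⟩
      · exact ⟨_, _, .orL h⟩
      · exact ⟨_, _, .orR h⟩
    · rintro ⟨_, _, h⟩
      cases h with
      | here => exact .inl rfl
      | orL h => exact .inr (.inl ⟨_, ⟨_, _, h⟩, rfl⟩)
      | orR h => exact .inr (.inr ⟨_, ⟨_, _, h⟩, rfl⟩)
  | and a b iha ihb =>
    simp only [disjPos, List.mem_append, List.mem_map, iha, ihb]
    constructor
    · rintro (⟨p, ⟨_, _, h⟩, rfl⟩ | ⟨p, ⟨_, _, h⟩, rfl⟩)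
      · exact ⟨_, _, .andL h⟩
      · exact ⟨_, _, .andR h⟩
    · rintro ⟨_, _, h⟩
      cases h with
      | andL h => exact .inl ⟨_, ⟨_, _, h⟩, rfl⟩
      | andR h => exact .inr ⟨_, ⟨_, _, h⟩, rfl⟩
  | imp a b iha ihb =>
    simp only [disjPos, List.mem_map, ihb]
    constructor
    · rintro ⟨p, ⟨_, _, h⟩, rfl⟩
      exact ⟨_, _, .impR h⟩
    · rintro ⟨_, _, h⟩
      cases h with
      | impR h => exact ⟨_, ⟨_, _, h⟩, rfl⟩

/-- A disjunction is listed before everything inside it, and positions below different immediate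
subformulas are incomparable. -/
theorem Formula.pairwise_disjPos (φ : Formula) :
    φ.disjPos.Pairwise fun p q => ¬ q <+: p := by
  have key : ∀ {l l' : List Pos}, l.Pairwise (fun p q => ¬ q <+: p) →
      l'.Pairwise (fun p q => ¬ q <+: p) →
      (l.map (false :: ·) ++ l'.map (true :: ·)).Pairwise fun p q => ¬ q <+: p := by
    intro l l' h h'
    simp only [List.pairwise_append, List.pairwise_map, List.mem_map]
    refine ⟨h.imp fun h => by simpa [List.cons_prefix_cons] using h,
      h'.imp fun h => by simpa [List.cons_prefix_cons] using h, ?_⟩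
    rintro _ ⟨p, _, rfl⟩ _ ⟨q, _, rfl⟩
    simp [List.cons_prefix_cons]
  induction φ with
  | var n => simp [disjPos]
  | bot => simp [disjPos]
  | or a b iha ihb =>
    refine List.pairwise_cons.2 ⟨fun q hq => ?_, key iha ihb⟩
    simp only [List.mem_append, List.mem_map] at hq
    rcases hq with ⟨p, _, rfl⟩ | ⟨p, _, rfl⟩ <;> simp
  | and a b iha ihb => exact key iha ihb
  | imp a b iha ihb => simpa [disjPos] using key (l := []) .nil ihb

theorem length_disjPos_le (φ : Formula) : φ.disjPos.length ≤ csize φ := by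
  induction φ <;>
    simp only [Formula.disjPos, List.length_nil, List.length_cons, List.length_append,
      List.length_map, csize_or, csize_and, csize_imp] <;> omega

theorem csize_map_cons_le (b : Bool) (l : List Pos) :
    csize (l.map (b :: ·)) ≤ csize l + 4 * l.length := by
  have := csize_bool_le b
  induction l with
  | nil => simp
  | cons p l ih => simp at *; omega

@[fun_prop]
theorem PolyTime.disjPos {α : Type} [Coded α] {f : α → Formula} (hf : PolyTime f) :
    PolyTime (fun x => (f x).disjPos) := by
  refine comp' (g := Formula.disjPos) ?_ hf
  have h₁ : PolyTime fun q : Formula × List Pos × List Pos => q.2.1.map (false :: ·) :=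
    PolyTime.map (by fun_prop) (by fun_prop)
  have h₂ : PolyTime fun q : Formula × List Pos × List Pos => q.2.2.map (true :: ·) :=
    PolyTime.map (by fun_prop) (by fun_prop)
  refine recursion (base := Formula.isPrime) (h := fun _ => []) (g₁ := Formula.fst)
    (g₂ := Formula.snd) (c := fun q => bif q.1.isImp then q.2.2.map (true :: ·) else
      bif q.1.isOr then [] :: (q.2.1.map (false :: ·) ++ q.2.2.map (true :: ·)) else
        q.2.1.map (false :: ·) ++ q.2.2.map (true :: ·))
    (by fun_prop) (by fun_prop) (by fun_prop) (by fun_prop) (by fun_prop) ?_ ?_ csize csize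
    csize_pos ?_ (fun _ => le_rfl) (fun _ => le_rfl) ?_ ?_ ⟨.X, fun x => by simp⟩ ?_
  · intro φ h; cases φ <;> first | rfl | simp [Formula.isPrime] at h
  · intro φ h; cases φ <;> rfl
  · intro φ h; have := csize_fst_add_snd h; omega
  · intro φ h; have := csize_fst_add_snd h; omega
  · intro φ h; have := csize_fst_add_snd h; omega
  · refine csize_le_of_additive (base := Formula.isPrime) (g₁ := Formula.fst) (g₂ := Formula.snd)
      csize csize csize_pos ?_ (fun _ => le_rfl) ?_ ?_ (4 * .X + 4) ?_ ?_
    · intro φ h; have := csize_fst_add_snd h; omega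
    · intro φ h; have := csize_fst_add_snd h; omega
    · intro φ h; have := csize_fst_add_snd h; omega
    · intro φ h; cases φ <;> simp_all [Formula.isPrime, Formula.disjPos]
    · intro φ h
      have key : ∀ a b : Formula, csize (a.disjPos.map (false :: ·) ++ b.disjPos.map (true :: ·)) ≤
          csize a.disjPos + csize b.disjPos + 4 * (csize a + csize b) := by
        intro a b
        have h₁ := csize_append (a.disjPos.map (false :: ·)) (b.disjPos.map (true :: ·))
        have h₂ := csize_map_cons_le false a.disjPos
        have h₃ := csize_map_cons_le true b.disjPos
        have := length_disjPos_le a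
        have := length_disjPos_le b
        omega
      cases φ with
      | var n => simp [Formula.isPrime] at h
      | bot => simp [Formula.isPrime] at h
      | or a b =>
        have := key a b
        simp only [Formula.disjPos, Formula.fst, Formula.snd, csize_or, csize_cons, csize_nil]
        simp
        omega
      | and a b =>
        have := key a b
        simp only [Formula.disjPos, Formula.fst, Formula.snd, csize_and]
        simp
        omega
      | imp a b =>
        have h₃ := csize_map_cons_le true b.disjPos
        have := length_disjPos_le b
        simp only [Formula.disjPos, Formula.fst, Formula.snd, csize_imp]
        simp
        omega

/-- The members of a list without repetitions. -/
def undup (l : List Formula) : List Formula :=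
  l.foldr (fun x acc => bif memb x acc then acc else x :: acc) []

theorem mem_undup {x : Formula} {l : List Formula} : x ∈ undup l ↔ x ∈ l := by
  induction l with
  | nil => rfl
  | cons a l ih =>
    change x ∈ (bif memb a (undup l) then undup l else a :: undup l) ↔ _
    by_cases h : a ∈ undup l
    · rw [memb_iff.2 h, cond_true, ih, List.mem_cons]
      refine ⟨.inr, ?_⟩
      rintro (rfl | h')
      · exact ih.1 h
      · exact h'
    · rw [Bool.eq_false_iff.2 fun h' => h (memb_iff.1 h'), cond_false, List.mem_cons, ih,
        List.mem_cons]

theorem nodup_undup (l : List Formula) : (undup l).Nodup := by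
  induction l with
  | nil => exact .nil
  | cons a l ih =>
    change (bif memb a (undup l) then undup l else a :: undup l).Nodup
    by_cases h : a ∈ undup l
    · rwa [memb_iff.2 h]
    · rw [Bool.eq_false_iff.2 fun h' => h (memb_iff.1 h')]
      exact List.nodup_cons.2 ⟨h, ih⟩

/-- An enumeration of the strictly positive disjunctions in a list of formulas. -/
def enumeration (l : List Formula) : List Occ :=
  ((undup l).map fun γ => γ.disjPos.map fun p => (γ, p)).flatten

theorem mem_enumeration {l : List Formula} {o : Occ} :
    o ∈ enumeration l ↔ o.1 ∈ l ∧ o.2 ∈ o.1.disjPos := by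
  simp only [enumeration, List.mem_flatten, List.mem_map, mem_undup]
  constructor
  · rintro ⟨_, ⟨γ, h, rfl⟩, h'⟩
    obtain ⟨p, hp, rfl⟩ := List.mem_map.1 h'
    exact ⟨h, hp⟩
  · rintro ⟨h, h'⟩
    exact ⟨_, ⟨o.1, h, rfl⟩, List.mem_map.2 ⟨o.2, h', rfl⟩⟩

/-- Occurrences in different formulas are never nested, so only the order within each formula
matters. An occurrence lies inside itself, so the nesting condition also excludes repetitions.
Removing duplicate formulas first is essential, as a code of a cedent may repeat its members. -/
theorem isEnumeration_enumeration (l : List Formula) :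
    IsEnumeration l.toFinset (enumeration l) := by
  have h : (enumeration l).Pairwise fun o o' => ¬ o.Inside o' := by
    rw [enumeration, List.pairwise_flatten]
    refine ⟨?_, ?_⟩
    · simp only [List.mem_map, forall_exists_index, and_imp, forall_apply_eq_imp_iff₂]
      intro γ _
      exact List.pairwise_map.2 (γ.pairwise_disjPos.imp fun h h' => h h'.2)
    · rw [List.pairwise_map]
      refine (nodup_undup l).imp fun {γ γ'} hne => ?_
      simp only [List.mem_map]
      rintro _ ⟨p, _, rfl⟩ _ ⟨q, _, rfl⟩ h
      exact hne h.1
  refine ⟨h.imp ?_, fun o => ?_, h⟩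
  · rintro o _ h rfl
    exact h ⟨rfl, List.prefix_rfl⟩
  · rw [mem_enumeration, Cedent.disjOcc, Set.mem_ofPred_eq, List.mem_toFinset,
      Formula.mem_disjPos]

theorem PolyTime.enumeration : PolyTime enumeration := by
  have h₁ : PolyTime undup := by
    refine foldr (l := fun l => l) (f := fun _ x acc => bif IPC.memb x acc then acc else x :: acc)
      (by fun_prop) (by fun_prop) (by fun_prop) ⟨.X, fun e x y => ?_⟩
    cases IPC.memb x y <;> simp; omega
  have h₂ : PolyTime fun p : List Formula × Formula => p.2.disjPos.map fun q => (p.2, q) :=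
    map (by fun_prop) (by fun_prop)
  have h₃ : PolyTime fun l : List Formula => (undup l).map fun γ => γ.disjPos.map fun p => (γ, p) :=
    map h₂ h₁
  exact flatten h₃

theorem enumeration_solvable :
    SolvableInPolyTime Cedent.IsCode (fun E w => w = enumCode E) IsEnumeration := by
  obtain ⟨p, B, h⟩ := PolyTime.enumeration
  refine ⟨p, B, ?_⟩
  rintro _ _ ⟨l, rfl, rfl⟩
  obtain ⟨t, ht, ht'⟩ := h p l
  exact ⟨_, _, t, isEnumeration_enumeration l, rfl, ht, ht'⟩

/-! ### Choosing the disjuncts -/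

/-- The bit with the index of the first occurrence of `o` in a list. -/
def bitAt (o : Occ) : List Occ → List Bool → Bool
  | [], k => k.headD false
  | x :: E, k => bif eqb x o then k.headD false else bitAt o E k.tail

/-- An occurrence missing from `E` has the length of `E` as its index. This is why `bitAt` still
reads the next bit when the list is exhausted: the equation then needs no membership hypothesis. -/
theorem bitAt_bits (o : Occ) (E : List Occ) (k : ℕ) : bitAt o E k.bits = k.testBit (E.idxOf o) := by
  rw [Nat.testBit_eq_inth]
  generalize k.bits = l
  induction E generalizing l with
  | nil => cases l <;> rfl
  | cons x E ih =>
    rw [bitAt, List.idxOf_cons]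
    by_cases h : x = o
    · rw [eqb_iff.2 h, cond_true, beq_iff_eq.2 h, cond_true]
      cases l <;> rfl
    · rw [Bool.eq_false_iff.2 fun h' => h (eqb_iff.1 h'), ih, cond_false]
      simp only [beq_eq_false_iff_ne.2 h, cond_false]
      cases l <;> simp

/-- The data on which a choice depends: an enumeration, a string of bits, and a formula. -/
abbrev ChoiceData : Type := (List Occ × List Bool) × Formula

/-- The choice at a position. -/
def ChoiceData.at (e : ChoiceData) (p : Pos) : Bool := bitAt (e.2, p) e.1.1 e.1.2

theorem choice_eq (E : List Occ) (k : ℕ) (γ : Formula) :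
    choice E k γ = ChoiceData.at ((E, k.bits), γ) :=
  funext fun _ => (bitAt_bits _ _ _).symm

section

variable {α : Type} [Coded α]

@[fun_prop]
theorem PolyTime.choiceAt {f : α → ChoiceData} {g : α → Pos} (hf : PolyTime f) (hg : PolyTime g) :
    PolyTime (fun x => (f x).at (g x)) := by
  have : PolyTime fun x : Occ × List Occ × List Bool => bitAt x.1 x.2.1 x.2.2 := by
    refine recursion (base := fun x => x.2.1.isEmpty) (h := fun x => x.2.2.headD false)
      (g₁ := fun x => (x.1, x.2.1.tail, x.2.2.tail)) (g₂ := fun x => (x.1, [], x.2.2))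
      (c := fun q => bif IPC.eqb (q.1.2.1.headD q.1.1) q.1.1 then q.1.2.2.headD false else q.2.1)
      (by fun_prop) (by fun_prop) (by fun_prop) (by fun_prop) (by fun_prop) ?_ ?_
      (fun x => 2 * x.2.1.length + 1) csize ?_ ?_ ?_ (fun _ => le_rfl) ?_ ?_
      ⟨.X, fun x => by simp⟩ ⟨3, fun x => (csize_bool_le _).trans (by simp)⟩
    · rintro ⟨o, E, k⟩ h; cases E <;> simp_all [bitAt]
    · rintro ⟨o, E, k⟩ h; cases E <;> simp_all [bitAt]
    · intro; omega
    · rintro ⟨o, E, k⟩ h; cases E <;> simp_all; omega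
    · rintro ⟨o, E, k⟩; have := length_le_csize E; simp; omega
    · rintro ⟨o, E, k⟩ h; cases E <;> cases k <;> simp_all <;> omega
    · rintro ⟨o, E, k⟩ h; cases E <;> simp_all
  exact comp' this (f := fun x => (((f x).2, g x), (f x).1.1, (f x).1.2)) (by fun_prop)

/-- The formula obtained by the choices in the formula `φ` at the position `p`. -/
def ChoiceData.choose (e : ChoiceData) (p : Pos) (φ : Formula) : Formula :=
  φ.choose fun q => e.at (p ++ q)

/-- Recursion equations in terms of positions counted from the root. `Formula.choose` shifts its
choice function instead, which a first-order program cannot pass along. -/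
theorem ChoiceData.choose_or (e : ChoiceData) (p : Pos) (a b : Formula) : e.choose p (.or a b) =
    bif e.at p then e.choose (p ++ [true]) b else e.choose (p ++ [false]) a := by
  cases h : e.at p <;> simp [ChoiceData.choose, Formula.choose, h]

theorem ChoiceData.choose_and (e : ChoiceData) (p : Pos) (a b : Formula) : e.choose p (.and a b) =
    .and (e.choose (p ++ [false]) a) (e.choose (p ++ [true]) b) := by
  simp [ChoiceData.choose, Formula.choose]

theorem ChoiceData.choose_imp (e : ChoiceData) (p : Pos) (a b : Formula) : e.choose p (.imp a b) =
    .imp a (e.choose (p ++ [true]) b) := by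
  simp [ChoiceData.choose, Formula.choose]

theorem csize_choose_le (c : Pos → Bool) (φ : Formula) : csize (φ.choose c) ≤ csize φ := by
  induction φ generalizing c with
  | var n => simp [Formula.choose]
  | bot => simp [Formula.choose]
  | or a b iha ihb =>
    have := iha fun p => c (false :: p)
    have := ihb fun p => c (true :: p)
    rw [Formula.choose, csize_or]
    split <;> omega
  | and a b iha ihb =>
    have := iha fun p => c (false :: p)
    have := ihb fun p => c (true :: p)
    rw [Formula.choose, csize_and, csize_and]
    omega
  | imp a b iha ihb =>
    have := ihb fun p => c (true :: p)
    rw [Formula.choose, csize_imp, csize_imp]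
    omega

theorem csize_append_singleton_le (p : Pos) (b : Bool) : csize (p ++ [b]) ≤ csize p + 4 := by
  have := csize_append p [b]
  have := csize_bool_le b
  simp at *
  omega

@[fun_prop]
theorem PolyTime.choose {f : α → ChoiceData} {g : α → Pos} {h : α → Formula} (hf : PolyTime f)
    (hg : PolyTime g) (hh : PolyTime h) : PolyTime (fun x => (f x).choose (g x) (h x)) := by
  refine comp' (g := fun x : ChoiceData × Pos × Formula => x.1.choose x.2.1 x.2.2) ?_
    (f := fun x => (f x, g x, h x)) (by fun_prop)
  refine recursion (base := fun x => x.2.2.isPrime) (h := fun x => x.2.2)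
    (g₁ := fun x => (x.1, x.2.1 ++ [false], x.2.2.fst))
    (g₂ := fun x => (x.1, x.2.1 ++ [true], x.2.2.snd))
    (c := fun q => bif q.1.2.2.isOr then bif q.1.1.at q.1.2.1 then q.2.2 else q.2.1 else
      bif q.1.2.2.isAnd then .and q.2.1 q.2.2 else .imp q.1.2.2.fst q.2.2)
    (by fun_prop) (by fun_prop) (by fun_prop) (by fun_prop) (by fun_prop) ?_ ?_
    (fun x => csize x.2.2) (fun x => csize x + csize x.2.2) (fun _ => csize_pos _) ?_ ?_ ?_ ?_ ?_
    ⟨2 * .X, ?_⟩ ⟨.X, ?_⟩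
  · rintro ⟨e, p, φ⟩ h
    cases φ <;> simp_all [Formula.isPrime, ChoiceData.choose, Formula.choose]
  · rintro ⟨e, p, φ⟩ h
    cases φ with
    | var n => simp [Formula.isPrime] at h
    | bot => simp [Formula.isPrime] at h
    | or a b => exact e.choose_or p a b
    | and a b => exact e.choose_and p a b
    | imp a b => exact e.choose_imp p a b
  · rintro ⟨e, p, φ⟩ h
    have := csize_fst_add_snd (φ := φ) h
    change csize φ.fst + csize φ.snd < csize φ
    omega
  · rintro ⟨e, p, φ⟩; simp
  · rintro ⟨e, p, φ⟩; simp
  -- The position gains at most four nodes while the formula loses at least eight.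
  · rintro ⟨e, p, φ⟩ h
    have := csize_fst_add_snd h
    have := csize_append_singleton_le p false
    simp only [csize_pair] at *; omega
  · rintro ⟨e, p, φ⟩ h
    have := csize_fst_add_snd h
    have := csize_append_singleton_le p true
    simp only [csize_pair] at *; omega
  · rintro ⟨e, p, φ⟩; simp; omega
  · rintro ⟨e, p, φ⟩
    have := csize_choose_le (fun q => e.at (p ++ q)) φ
    simp [ChoiceData.choose]; omega

end

/-! ### Codes of derivations -/

/-- The code of an inference with the label `i`, the conclusion `L ⇒ φ` and the given codes of the
premises. -/
def inferT (i : ℕ) (L : List Formula) (φ : Formula) (ch : List Tree) : Tree :=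
  .node (.label i) (.node (.node (enc L) (enc φ)) (enc ch))

@[fun_prop]
theorem PolyTime.inferT {α : Type} [Coded α] (i : ℕ) {f : α → List Formula} {g : α → Formula}
    {h : α → List Tree} (hf : PolyTime f) (hg : PolyTime g) (hh : PolyTime h) :
    PolyTime (fun x => inferT i (f x) (g x) (h x)) := by
  unfold IPC.inferT
  fun_prop

theorem size_label (i : ℕ) : (Tree.label i).size = 2 * i + 1 := by
  induction i with
  | zero => rfl
  | succ n ih => simp only [Tree.label, Tree.size, ih]; omega

theorem size_inferT (i : ℕ) (L : List Formula) (φ : Formula) (ch : List Tree) :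
    (inferT i L φ ch).size = 2 * i + 4 + csize L + csize φ + csize ch := by
  simp only [inferT, Tree.size, size_label, csize]
  omega

theorem Sequent.IsCode.exists_list {s : Sequent} {w : Tree} (h : s.IsCode w) :
    ∃ l : List Formula, l.toFinset = s.ant ∧ w = enc (l, s.succ) := by
  obtain ⟨_, ⟨l, h, rfl⟩, rfl⟩ := h
  exact ⟨l, h, rfl⟩

namespace Derivation

/-- All rules share one layout: the conclusion is at `rgt.lft` and the list of premises at
`rgt.rgt`, so programs need not distinguish the rules. -/
theorem IsCode.concl {d : Derivation} {w : Tree} (h : d.IsCode w) :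
    d.concl.IsCode w.rgt.lft := by
  cases d with
  | ax s => obtain ⟨v, hv, rfl⟩ := h; exact hv
  | botAx s => obtain ⟨v, hv, rfl⟩ := h; exact hv
  | orE s d d₀ d₁ => obtain ⟨v, a, a₀, a₁, hv, _, _, _, rfl⟩ := h; exact hv
  | orI i s d => obtain ⟨v, a, hv, _, rfl⟩ := h; exact hv
  | andE i s d => obtain ⟨v, a, hv, _, rfl⟩ := h; exact hv
  | andI s d e => obtain ⟨v, a, a', hv, _, _, rfl⟩ := h; exact hv
  | impE s d e => obtain ⟨v, a, a', hv, _, _, rfl⟩ := h; exact hv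
  | impI s d => obtain ⟨v, a, hv, _, rfl⟩ := h; exact hv

variable {X : Cedent} {L : List Formula} {φ : Formula} {d e : Derivation} {a b : Tree}

theorem isCode_ax (hL : L.toFinset = X) : (ax ⟨X, φ⟩).IsCode (inferT 0 L φ []) :=
  ⟨_, ⟨_, ⟨L, hL, rfl⟩, rfl⟩, rfl⟩

theorem isCode_orI (i : Bool) (hL : L.toFinset = X) (hd : d.IsCode a) :
    (orI i ⟨X, φ⟩ d).IsCode (inferT (if i then 4 else 3) L φ [a]) :=
  ⟨_, a, ⟨_, ⟨L, hL, rfl⟩, rfl⟩, hd, rfl⟩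

theorem isCode_andE (i : Bool) (hL : L.toFinset = X) (hd : d.IsCode a) :
    (andE i ⟨X, φ⟩ d).IsCode (inferT (if i then 6 else 5) L φ [a]) :=
  ⟨_, a, ⟨_, ⟨L, hL, rfl⟩, rfl⟩, hd, rfl⟩

theorem isCode_andI (hL : L.toFinset = X) (hd : d.IsCode a) (he : e.IsCode b) :
    (andI ⟨X, φ⟩ d e).IsCode (inferT 7 L φ [a, b]) :=
  ⟨_, a, b, ⟨_, ⟨L, hL, rfl⟩, rfl⟩, hd, he, rfl⟩

theorem isCode_impE (hL : L.toFinset = X) (hd : d.IsCode a) (he : e.IsCode b) :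
    (impE ⟨X, φ⟩ d e).IsCode (inferT 8 L φ [a, b]) :=
  ⟨_, a, b, ⟨_, ⟨L, hL, rfl⟩, rfl⟩, hd, he, rfl⟩

theorem isCode_impI (hL : L.toFinset = X) (hd : d.IsCode a) :
    (impI ⟨X, φ⟩ d).IsCode (inferT 9 L φ [a]) :=
  ⟨_, a, ⟨_, ⟨L, hL, rfl⟩, rfl⟩, hd, rfl⟩

/-- The derivation of `X ⇒ α` from derivations of `β, X ⇒ α` and of `X ⇒ β`. -/
def detach (X : Cedent) (β α : Formula) (d e : Derivation) : Derivation :=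
  impE ⟨X, α⟩ (impI ⟨X, .imp β α⟩ d) e

/-- The calculus has no cut rule; ⊃-introduction followed by ⊃-elimination takes its place. -/
theorem derives_detach {β α : Formula} (hd : d.Derives (insert β X) α) (he : e.Derives X β) :
    (detach X β α d e).Derives X α :=
  ⟨⟨⟨β, rfl, he.2⟩, ⟨⟨β, α, rfl, hd.2⟩, hd.1⟩, he.1⟩, rfl⟩

end Derivation

/-- The code of `Derivation.detach`. -/
def detachT (L : List Formula) (β α : Formula) (a b : Tree) : Tree :=
  inferT 8 L α [inferT 9 L (.imp β α) [a], b]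

theorem Derivation.isCode_detach {X : Cedent} {L : List Formula} {β α : Formula}
    {d e : Derivation} {a b : Tree} (hL : L.toFinset = X) (hd : d.IsCode a) (he : e.IsCode b) :
    (detach X β α d e).IsCode (detachT L β α a b) :=
  isCode_impE hL (isCode_impI hL hd) he

@[fun_prop]
theorem PolyTime.detachT {ε : Type} [Coded ε] {L : ε → List Formula} {β α : ε → Formula}
    {a b : ε → Tree} (hL : PolyTime L) (hβ : PolyTime β) (hα : PolyTime α) (ha : PolyTime a)
    (hb : PolyTime b) : PolyTime (fun x => detachT (L x) (β x) (α x) (a x) (b x)) := by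
  unfold IPC.detachT
  fun_prop

theorem size_detachT (L : List Formula) (β α : Formula) (a b : Tree) :
    (detachT L β α a b).size = a.size + b.size + 2 * csize L + 2 * csize α + csize β + 58 := by
  simp only [detachT, size_inferT, csize_cons, csize_nil, csize_imp, csize_tree]
  omega

/-! ### Deriving a formula from the formula obtained by choices -/

/-- A derivation of `φ(k), X ⇒ φ`. -/
def expand (e : ChoiceData) : Pos → Cedent → Formula → Derivation
  | p, X, .or a b =>
    let Y := insert (e.choose p (.or a b)) X
    bif e.at p then .orI true ⟨Y, .or a b⟩ (expand e (p ++ [true]) X b)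
    else .orI false ⟨Y, .or a b⟩ (expand e (p ++ [false]) X a)
  | p, X, .and a b =>
    let A := e.choose (p ++ [false]) a
    let B := e.choose (p ++ [true]) b
    let Y := insert (e.choose p (.and a b)) X
    .andI ⟨Y, .and a b⟩
      (.detach Y A a (expand e (p ++ [false]) Y a) (.andE false ⟨Y, A⟩ (.ax ⟨Y, .and A B⟩)))
      (.detach Y B b (expand e (p ++ [true]) Y b) (.andE true ⟨Y, B⟩ (.ax ⟨Y, .and A B⟩)))
  | p, X, .imp a b =>
    let B := e.choose (p ++ [true]) b
    let Y := insert (e.choose p (.imp a b)) X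
    let Z := insert a Y
    .impI ⟨Y, .imp a b⟩
      (.detach Z B b (expand e (p ++ [true]) Z b)
        (.impE ⟨Z, B⟩ (.ax ⟨Z, .imp a B⟩) (.ax ⟨Z, a⟩)))
  | p, X, φ => .ax ⟨insert (e.choose p φ) X, φ⟩

/-- Choosing a disjunct strengthens a disjunction, and strictly positive positions are covariant:
they are never in the antecedent of an implication. In the cases of ∧ and ⊃ the chosen components
are first derived from the chosen formula and then detached. Antecedents of premises must match
exactly, so the side formulas are threaded through the recursion. -/
theorem derives_expand (e : ChoiceData) (p : Pos) (X : Cedent) (φ : Formula) :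
    (expand e p X φ).Derives (insert (e.choose p φ) X) φ := by
  induction φ generalizing p X with
  | var n =>
    refine ⟨?_, rfl⟩
    simp [expand, Derivation.Correct, ChoiceData.choose, Formula.choose]
  | bot =>
    refine ⟨?_, rfl⟩
    simp [expand, Derivation.Correct, ChoiceData.choose, Formula.choose]
  | or a b iha ihb =>
    have h := e.choose_or p a b
    cases hp : e.at p <;> rw [hp] at h <;> simp only [cond_true, cond_false] at h <;>
      simp only [expand, hp, cond_true, cond_false]
    -- The choice in a disjunction is the choice in the selected disjunct, so premise and conclusion
    -- have the same antecedent.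
    · exact ⟨⟨⟨a, b, rfl, by rw [h]; exact (iha _ _).2⟩, (iha _ _).1⟩, rfl⟩
    · exact ⟨⟨⟨a, b, rfl, by rw [h]; exact (ihb _ _).2⟩, (ihb _ _).1⟩, rfl⟩
  | and a b iha ihb =>
    have h := e.choose_and p a b
    have ax : Formula.and (e.choose (p ++ [false]) a) (e.choose (p ++ [true]) b) ∈
      insert (e.choose p (.and a b)) X := by rw [h]; exact Finset.mem_insert_self _ _
    have h₀ := Derivation.derives_detach (iha (p ++ [false]) (insert (e.choose p (.and a b)) X))
      (e := .andE false ⟨_, e.choose (p ++ [false]) a⟩ (.ax ⟨_, .and _ _⟩))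
      ⟨⟨⟨_, _, rfl, rfl⟩, ax⟩, rfl⟩
    have h₁ := Derivation.derives_detach (ihb (p ++ [true]) (insert (e.choose p (.and a b)) X))
      (e := .andE true ⟨_, e.choose (p ++ [true]) b⟩ (.ax ⟨_, .and _ _⟩))
      ⟨⟨⟨_, _, rfl, rfl⟩, ax⟩, rfl⟩
    exact ⟨⟨⟨a, b, rfl, h₀.2, h₁.2⟩, h₀.1, h₁.1⟩, rfl⟩
  | imp a b iha ihb =>
    have h := e.choose_imp p a b
    have ax : Formula.imp a (e.choose (p ++ [true]) b) ∈
        insert a (insert (e.choose p (.imp a b)) X) := by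
      rw [h]; exact Finset.mem_insert_of_mem (Finset.mem_insert_self _ _)
    have h₁ := Derivation.derives_detach
      (ihb (p ++ [true]) (insert a (insert (e.choose p (.imp a b)) X)))
      (e := .impE ⟨_, e.choose (p ++ [true]) b⟩ (.ax ⟨_, .imp a _⟩) (.ax ⟨_, a⟩))
      ⟨⟨⟨a, rfl, rfl⟩, ax, Finset.mem_insert_self _ _⟩, rfl⟩
    exact ⟨⟨⟨a, b, rfl, h₁.2⟩, h₁.1⟩, rfl⟩

/-- The code of `expand`. -/
def expandT (e : ChoiceData) : Pos → List Formula → Formula → Tree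
  | p, L, .or a b =>
    let Y := e.choose p (.or a b) :: L
    bif e.at p then inferT 4 Y (.or a b) [expandT e (p ++ [true]) L b]
    else inferT 3 Y (.or a b) [expandT e (p ++ [false]) L a]
  | p, L, .and a b =>
    let A := e.choose (p ++ [false]) a
    let B := e.choose (p ++ [true]) b
    let Y := e.choose p (.and a b) :: L
    inferT 7 Y (.and a b)
      [detachT Y A a (expandT e (p ++ [false]) Y a) (inferT 5 Y A [inferT 0 Y (.and A B) []]),
        detachT Y B b (expandT e (p ++ [true]) Y b) (inferT 6 Y B [inferT 0 Y (.and A B) []])]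
  | p, L, .imp a b =>
    let B := e.choose (p ++ [true]) b
    let Y := e.choose p (.imp a b) :: L
    let Z := a :: Y
    inferT 9 Y (.imp a b)
      [detachT Z B b (expandT e (p ++ [true]) Z b)
        (inferT 8 Z B [inferT 0 Z (.imp a B) [], inferT 0 Z a []])]
  | p, L, φ => inferT 0 (e.choose p φ :: L) φ []

theorem isCode_expand (e : ChoiceData) (p : Pos) {X : Cedent} {L : List Formula} (φ : Formula)
    (hL : L.toFinset = X) : (expand e p X φ).IsCode (expandT e p L φ) := by
  induction φ generalizing p X L with
  | var n => exact Derivation.isCode_ax (by simp [hL])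
  | bot => exact Derivation.isCode_ax (by simp [hL])
  | or a b iha ihb =>
    have hY : (e.choose p (.or a b) :: L).toFinset = insert (e.choose p (.or a b)) X := by
      simp [hL]
    cases hp : e.at p <;> simp only [expand, expandT, hp, cond_true, cond_false]
    · exact Derivation.isCode_orI false hY (iha _ hL)
    · exact Derivation.isCode_orI true hY (ihb _ hL)
  | and a b iha ihb =>
    have hY : (e.choose p (.and a b) :: L).toFinset = insert (e.choose p (.and a b)) X := by
      simp [hL]
    exact Derivation.isCode_andI hY
      (Derivation.isCode_detach hY (iha _ hY) (Derivation.isCode_andE false hY (Derivation.isCode_ax hY)))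
      (Derivation.isCode_detach hY (ihb _ hY) (Derivation.isCode_andE true hY (Derivation.isCode_ax hY)))
  | imp a b iha ihb =>
    have hY : (e.choose p (.imp a b) :: L).toFinset = insert (e.choose p (.imp a b)) X := by
      simp [hL]
    have hZ : (a :: e.choose p (.imp a b) :: L).toFinset =
        insert a (insert (e.choose p (.imp a b)) X) := by
      rw [← hY]; simp
    exact Derivation.isCode_impI hY (Derivation.isCode_detach hZ (ihb _ hZ)
      (Derivation.isCode_impE hZ (Derivation.isCode_ax hZ) (Derivation.isCode_ax hZ)))

@[fun_prop]
theorem PolyTime.expandT {α : Type} [Coded α] {f : α → ChoiceData} {g : α → Pos}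
    {L : α → List Formula} {h : α → Formula} (hf : PolyTime f) (hg : PolyTime g)
    (hL : PolyTime L) (hh : PolyTime h) :
    PolyTime (fun x => expandT (f x) (g x) (L x) (h x)) := by
  refine comp' (g := fun x : ChoiceData × Pos × List Formula × Formula =>
    IPC.expandT x.1 x.2.1 x.2.2.1 x.2.2.2) ?_ (f := fun x => (f x, g x, L x, h x)) (by fun_prop)
  let base : ChoiceData × Pos × List Formula × Formula → Bool := fun x => x.2.2.2.isPrime
  let Y : ChoiceData × Pos × List Formula × Formula → List Formula :=
    fun x => x.1.choose x.2.1 x.2.2.2 :: x.2.2.1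
  -- Both calls are always made. The values for a dropped disjunct and for the antecedent of an
  -- implication are discarded in `c`; the measures still add up.
  let g₁ : ChoiceData × Pos × List Formula × Formula → ChoiceData × Pos × List Formula × Formula :=
    fun x => (x.1, x.2.1 ++ [false], bif x.2.2.2.isOr then x.2.2.1 else Y x, x.2.2.2.fst)
  let g₂ : ChoiceData × Pos × List Formula × Formula → ChoiceData × Pos × List Formula × Formula :=
    fun x => (x.1, x.2.1 ++ [true], bif x.2.2.2.isOr then x.2.2.1 else
      bif x.2.2.2.isAnd then Y x else x.2.2.2.fst :: Y x, x.2.2.2.snd)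
  let A : ChoiceData × Pos × List Formula × Formula → Formula :=
    fun x => x.1.choose (x.2.1 ++ [false]) x.2.2.2.fst
  let B : ChoiceData × Pos × List Formula × Formula → Formula :=
    fun x => x.1.choose (x.2.1 ++ [true]) x.2.2.2.snd
  let c : (ChoiceData × Pos × List Formula × Formula) × Tree × Tree → Tree := fun q =>
    bif q.1.2.2.2.isOr then
      bif q.1.1.at q.1.2.1 then IPC.inferT 4 (Y q.1) q.1.2.2.2 [q.2.2]
      else IPC.inferT 3 (Y q.1) q.1.2.2.2 [q.2.1]
    else bif q.1.2.2.2.isAnd then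
      IPC.inferT 7 (Y q.1) q.1.2.2.2
        [IPC.detachT (Y q.1) (A q.1) q.1.2.2.2.fst q.2.1
          (IPC.inferT 5 (Y q.1) (A q.1) [IPC.inferT 0 (Y q.1) (.and (A q.1) (B q.1)) []]),
        IPC.detachT (Y q.1) (B q.1) q.1.2.2.2.snd q.2.2
          (IPC.inferT 6 (Y q.1) (B q.1) [IPC.inferT 0 (Y q.1) (.and (A q.1) (B q.1)) []])]
    else
      IPC.inferT 9 (Y q.1) q.1.2.2.2
        [IPC.detachT (q.1.2.2.2.fst :: Y q.1) (B q.1) q.1.2.2.2.snd q.2.2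
          (IPC.inferT 8 (q.1.2.2.2.fst :: Y q.1) (B q.1)
            [IPC.inferT 0 (q.1.2.2.2.fst :: Y q.1) (.imp q.1.2.2.2.fst (B q.1)) [],
              IPC.inferT 0 (q.1.2.2.2.fst :: Y q.1) q.1.2.2.2.fst []])]
  have F_rec : ∀ x : ChoiceData × Pos × List Formula × Formula, base x = false →
      IPC.expandT x.1 x.2.1 x.2.2.1 x.2.2.2 =
      c (x, IPC.expandT (g₁ x).1 (g₁ x).2.1 (g₁ x).2.2.1 (g₁ x).2.2.2,
        IPC.expandT (g₂ x).1 (g₂ x).2.1 (g₂ x).2.2.1 (g₂ x).2.2.2) := by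
    rintro ⟨e, p, L, φ⟩ h
    cases φ with
    | var n => simp [base, Formula.isPrime] at h
    | bot => simp [base, Formula.isPrime] at h
    | or a b => rfl
    | and a b => rfl
    | imp a b => rfl
  have F_base : ∀ x : ChoiceData × Pos × List Formula × Formula, base x = true →
      IPC.expandT x.1 x.2.1 x.2.2.1 x.2.2.2 = IPC.inferT 0 (Y x) x.2.2.2 [] := by
    rintro ⟨e, p, L, φ⟩ h
    cases φ <;> first | rfl | simp [base, Formula.isPrime] at h
  have hY : PolyTime Y := by fun_prop
  have hA : PolyTime A := by fun_prop
  have hB : PolyTime B := by fun_prop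
  have m_add : ∀ x, base x = false → csize (g₁ x).2.2.2 + csize (g₂ x).2.2.2 + 7 ≤
    csize x.2.2.2 := fun x h => csize_fst_add_snd h
  have Y_le : ∀ x, csize (Y x) ≤ csize x.2.2.1 + csize x.2.2.2 + 1 := by
    rintro ⟨e, p, L, φ⟩
    have := csize_choose_le (fun q => e.at (p ++ q)) φ
    simp only [Y, csize_cons, ChoiceData.choose]; omega
  have A_le : ∀ x, csize (A x) ≤ csize x.2.2.2.fst := fun x => csize_choose_le _ _
  have B_le : ∀ x, csize (B x) ≤ csize x.2.2.2.snd := fun x => csize_choose_le _ _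
  -- One level enlarges the context by at most twice the size of the current formula plus 2, and the
  -- depth is at most that size. The quadratic term pays for all future growth of the context, the
  -- linear one for the longer positions.
  let Φ : ChoiceData × Pos × List Formula × Formula → ℕ :=
    fun x => csize x + 4 * csize x.2.2.2 + 2 * (csize x.2.2.2 * csize x.2.2.2)
  have quad : ∀ m n : ℕ, m + 8 ≤ n → 2 * (m * m) + 2 * n + 16 ≤ 2 * (n * n) := by
    intro m n h; nlinarith
  have Φ₁ : ∀ x, base x = false → Φ (g₁ x) ≤ Φ x := by
    rintro ⟨e, p, L, φ⟩ h
    have h₁ : csize (Y (e, p, L, φ)) ≤ csize L + csize φ + 1 := Y_le (e, p, L, φ)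
    have h₂ := csize_fst_add_snd (φ := φ) h
    have h₃ := csize_append_singleton_le p false
    have h₄ := csize_pos φ.snd
    have h₅ := quad (csize φ.fst) (csize φ) (by omega)
    have h₆ : csize (bif φ.isOr then L else Y (e, p, L, φ)) ≤
        csize L + csize φ + 1 := by
      cases φ.isOr <;> simp only [cond_true, cond_false] <;> omega
    simp only [Φ, g₁, csize_pair]
    omega
  have Φ₂ : ∀ x, base x = false → Φ (g₂ x) ≤ Φ x := by
    rintro ⟨e, p, L, φ⟩ h
    have h₁ : csize (Y (e, p, L, φ)) ≤ csize L + csize φ + 1 := Y_le (e, p, L, φ)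
    have h₂ := csize_fst_add_snd (φ := φ) h
    have h₃ := csize_append_singleton_le p true
    have h₄ := csize_pos φ.fst
    have h₅ := quad (csize φ.snd) (csize φ) (by omega)
    have h₆ : csize (bif φ.isOr then L else
        bif φ.isAnd then Y (e, p, L, φ) else φ.fst :: Y (e, p, L, φ)) ≤
        csize L + 2 * csize φ + 2 := by
      cases φ.isOr <;> cases φ.isAnd <;> simp only [cond_true, cond_false, csize_cons] <;> omega
    simp only [Φ, g₂, csize_pair]
    omega
  refine recursion (base := base) (h := fun x => IPC.inferT 0 (Y x) x.2.2.2 [])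
    (g₁ := g₁) (g₂ := g₂) (c := c) (by fun_prop) (by fun_prop) (by fun_prop) (by fun_prop)
    (by fun_prop) F_base F_rec (fun x => csize x.2.2.2) Φ (fun _ => csize_pos _) ?_ ?_ ?_ Φ₁ Φ₂
    ⟨5 * .X + 2 * (.X * .X), ?_⟩ ?_
  · intro x h; have := m_add x h; omega
  · intro x; simp only [Φ]; omega
  · intro x; simp only [Φ]; omega
  · rintro ⟨e, p, L, φ⟩
    have h₁ : csize φ ≤ csize (e, p, L, φ) := by simp only [csize_pair]; omega
    have h₂ := Nat.mul_le_mul h₁ h₁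
    simp only [Φ, Polynomial.eval_add, Polynomial.eval_mul, Polynomial.eval_X,
      Polynomial.eval_ofNat]
    omega
  -- Each level writes a bounded number of formulas and contexts, hence an amount linear in the
  -- potential.
  · refine csize_le_of_additive (base := base) (g₁ := g₁) (g₂ := g₂) (fun x => csize x.2.2.2) Φ
      (fun _ => csize_pos _) ?_ ?_ Φ₁ Φ₂ (50 * .X + 500) ?_ ?_
    · intro x h; have := m_add x h; omega
    · intro x; simp only [Φ]; omega
    · intro x h
      rw [F_base x h]
      have h₁ := Y_le x
      obtain ⟨e, p, L, φ⟩ := x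
      simp only [csize_tree, size_inferT, csize_nil, csize_pair, Φ, Polynomial.eval_add,
        Polynomial.eval_mul, Polynomial.eval_X, Polynomial.eval_ofNat] at *
      omega
    · intro x h
      rw [F_rec x h]
      have h₁ := Y_le x
      have h₂ := A_le x
      have h₃ := B_le x
      have h₄ := csize_fst_add_snd (φ := x.2.2.2) h
      generalize IPC.expandT (g₁ x).1 (g₁ x).2.1 (g₁ x).2.2.1 (g₁ x).2.2.2 = y₁
      generalize IPC.expandT (g₂ x).1 (g₂ x).2.1 (g₂ x).2.2.1 (g₂ x).2.2.2 = y₂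
      have h₅ : csize x.2.2.1 + csize x.2.2.2 ≤ Φ x := by
        obtain ⟨e, p, L, φ⟩ := x
        simp only [Φ, csize_pair]
        omega
      simp only [csize_tree, Polynomial.eval_add, Polynomial.eval_mul, Polynomial.eval_X,
        Polynomial.eval_ofNat]
      generalize Φ x = n at *
      simp only [c]
      cases x.2.2.2.isOr <;> cases x.2.2.2.isAnd <;> cases x.1.at x.2.1 <;>
        simp only [cond_true, cond_false, size_inferT, size_detachT, csize_cons, csize_nil,
          csize_tree, csize_and, csize_imp] <;> omega

/-! ### Recursion on the codes of derivations -/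

theorem Tree.size_lft_le (t : Tree) : t.lft.size ≤ t.size := by
  cases t <;> simp only [Tree.lft, Tree.size] <;> omega

theorem Tree.size_rgt_le (t : Tree) : t.rgt.size ≤ t.size := by
  cases t <;> simp only [Tree.rgt, Tree.size] <;> omega

/-- Recursion on lists of codes of derivations. -/
theorem PolyTime.forest {ε β : Type} [Coded ε] [Coded β] {F : ε → Tree → β} {h : ε → β}
    {c : ε → Tree → β → β → β} (hh : PolyTime h)
    (hc : PolyTime fun p : ε × Tree × β × β => c p.1 p.2.1 p.2.2.1 p.2.2.2)
    (F_nil : ∀ e, F e .nil = h e)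
    (F_node : ∀ e d r, F e (.node d r) = c e d (F e d.rgt.rgt) (F e r))
    (le : ∃ Q : Polynomial ℕ, ∀ e d y z, csize (c e d y z) ≤
      csize y + csize z + Q.eval (csize (e, d))) :
    PolyTime fun p : ε × Tree => F p.1 p.2 := by
  have h₁ : ∀ x : ε × Tree, IPC.eqb x.2 .nil = true → x.2 = .nil := fun x => eqb_iff.1
  have h₂ : ∀ x : ε × Tree, IPC.eqb x.2 .nil = false → ∃ d r, x.2 = .node d r := by
    rintro ⟨e, t⟩ h
    cases t with
    | nil => simp [Bool.eq_false_iff] at h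
    | node d r => exact ⟨d, r, rfl⟩
  -- The calls go to the list of premises of the first derivation and to the rest of the list. These
  -- are disjoint subtrees, so binary recursion handles rules of any arity.
  have m_add : ∀ x : ε × Tree, IPC.eqb x.2 .nil = false →
      x.2.lft.rgt.rgt.size + x.2.rgt.size < x.2.size := by
    rintro ⟨e, t⟩ h
    obtain ⟨d, r, rfl⟩ := h₂ _ h
    have := d.size_rgt_le
    have := d.rgt.size_rgt_le
    change d.rgt.rgt.size + r.size < d.size + r.size + 1
    omega
  have hc' := comp' hc (f := fun q : (ε × Tree) × β × β => (q.1.1, q.1.2.lft, q.2.1, q.2.2))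
    (by fun_prop)
  refine recursion (base := fun x => IPC.eqb x.2 .nil) (h := fun x => h x.1)
    (g₁ := fun x => (x.1, x.2.lft.rgt.rgt)) (g₂ := fun x => (x.1, x.2.rgt))
    (by fun_prop) (by fun_prop) (by fun_prop) (by fun_prop) hc' ?_ ?_ (fun x => x.2.size) csize
    (fun _ => Tree.size_pos _) m_add (fun ⟨e, t⟩ => by simp; omega) (fun _ => le_rfl)
    ?_ ?_ ⟨.X, fun x => by simp⟩ ?_
  · rintro ⟨e, t⟩ h; obtain rfl := h₁ _ h; exact F_nil e
  · rintro ⟨e, t⟩ h; obtain ⟨d, r, rfl⟩ := h₂ _ h; exact F_node e d r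
  · rintro ⟨e, t⟩ h; have := m_add _ h; simp at *; omega
  · rintro ⟨e, t⟩ h; have := m_add _ h; simp at *; omega
  · obtain ⟨Q, hQ⟩ := le
    obtain ⟨H, hH⟩ := hh.csize_le
    refine csize_le_of_additive (base := fun x : ε × Tree => IPC.eqb x.2 .nil)
      (g₁ := fun x => (x.1, x.2.lft.rgt.rgt)) (g₂ := fun x => (x.1, x.2.rgt))
      (fun x => x.2.size) csize (fun _ => Tree.size_pos _) m_add
      (fun ⟨e, t⟩ => by simp; omega) ?_ ?_ (H + Q) ?_ ?_
    · rintro ⟨e, t⟩ h; have := m_add _ h; simp at *; omega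
    · rintro ⟨e, t⟩ h; have := m_add _ h; simp at *; omega
    · rintro ⟨e, t⟩ h
      obtain rfl := h₁ _ h
      have := (hH e).trans (Polynomial.eval_mono_nat H
        (show csize e ≤ csize (e, Tree.nil) by simp; omega))
      simp only [F_nil, Polynomial.eval_add]
      omega
    · rintro ⟨e, t⟩ h
      obtain ⟨d, r, rfl⟩ := h₂ _ h
      have := hQ e d (F e d.rgt.rgt) (F e r)
      have := Polynomial.eval_mono_nat Q
        (show csize (e, d) ≤ csize (e, Tree.node d r) by simp [Tree.size]; omega)
      rw [Polynomial.eval_add]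
      change csize (F e (.node d r)) ≤ csize (F e d.rgt.rgt) + csize (F e r) + _
      rw [F_node]
      omega

/-! ### Weakening -/

namespace Derivation

/-- Adding formulas to all antecedents. -/
def weaken (Δ : Cedent) : Derivation → Derivation
  | ax s => ax ⟨Δ ∪ s.ant, s.succ⟩
  | botAx s => botAx ⟨Δ ∪ s.ant, s.succ⟩
  | orE s d d₀ d₁ => orE ⟨Δ ∪ s.ant, s.succ⟩ (d.weaken Δ) (d₀.weaken Δ) (d₁.weaken Δ)
  | orI i s d => orI i ⟨Δ ∪ s.ant, s.succ⟩ (d.weaken Δ)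
  | andE i s d => andE i ⟨Δ ∪ s.ant, s.succ⟩ (d.weaken Δ)
  | andI s d e => andI ⟨Δ ∪ s.ant, s.succ⟩ (d.weaken Δ) (e.weaken Δ)
  | impE s d e => impE ⟨Δ ∪ s.ant, s.succ⟩ (d.weaken Δ) (e.weaken Δ)
  | impI s d => impI ⟨Δ ∪ s.ant, s.succ⟩ (d.weaken Δ)

theorem concl_weaken (Δ : Cedent) (d : Derivation) :
    (d.weaken Δ).concl = ⟨Δ ∪ d.concl.ant, d.concl.succ⟩ := by
  cases d <;> rfl

theorem Correct.weaken (Δ : Cedent) {d : Derivation} (h : d.Correct) : (d.weaken Δ).Correct := by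
  induction d with
  | ax s => exact Finset.mem_union_right _ h
  | botAx s => exact ⟨Finset.mem_union_right _ h.1, h.2⟩
  | orE s d d₀ d₁ ih ih₀ ih₁ =>
    obtain ⟨⟨α₀, α₁, h, h₀, h₁⟩, k, k₀, k₁⟩ := h
    refine ⟨⟨α₀, α₁, ?_, ?_, ?_⟩, ih k, ih₀ k₀, ih₁ k₁⟩ <;>
      simp [concl_weaken, h, h₀, h₁, Finset.union_insert]
  | orI i s d ih =>
    obtain ⟨⟨α₀, α₁, h, h₀⟩, k⟩ := h
    exact ⟨⟨α₀, α₁, h, by simp [concl_weaken, h₀]⟩, ih k⟩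
  | andE i s d ih =>
    obtain ⟨⟨α₀, α₁, h, h₀⟩, k⟩ := h
    exact ⟨⟨α₀, α₁, by simp [concl_weaken, h], h₀⟩, ih k⟩
  | andI s d e ih ih' =>
    obtain ⟨⟨α₀, α₁, h, h₀, h₁⟩, k, k'⟩ := h
    exact ⟨⟨α₀, α₁, h, by simp [concl_weaken, h₀], by simp [concl_weaken, h₁]⟩, ih k, ih' k'⟩
  | impE s d e ih ih' =>
    obtain ⟨⟨α, h₀, h₁⟩, k, k'⟩ := h
    exact ⟨⟨α, by simp [concl_weaken, h₀], by simp [concl_weaken, h₁]⟩, ih k, ih' k'⟩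
  | impI s d ih =>
    obtain ⟨⟨α, β, h, h₀⟩, k⟩ := h
    exact ⟨⟨α, β, h, by simp [concl_weaken, h₀, Finset.union_insert]⟩, ih k⟩

end Derivation

/-- The code of `L ++ l`, where `t` is the code of `l`. -/
def consAll (L : List Formula) (t : Tree) : Tree := L.foldr (fun a t => .node (enc a) t) t

theorem consAll_enc (L l : List Formula) : consAll L (enc l) = enc (L ++ l) := by
  induction L with
  | nil => rfl
  | cons a L ih => exact congrArg (Tree.node (enc a)) ih

theorem size_consAll (L : List Formula) (t : Tree) :
    (consAll L t).size + 1 = csize L + t.size := by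
  induction L with
  | nil => simp [consAll, Nat.add_comm]
  | cons a L ih =>
    change (enc a).size + (consAll L t).size + 1 + 1 = (enc a).size + csize L + 1 + t.size
    omega

@[fun_prop]
theorem PolyTime.consAll {α : Type} [Coded α] {f : α → List Formula} {g : α → Tree}
    (hf : PolyTime f) (hg : PolyTime g) : PolyTime (fun x => consAll (f x) (g x)) :=
  foldr (f := fun _ a t => Tree.node (enc a) t) (by fun_prop) hg hf ⟨.X, fun e x y => by
    change (enc x).size + y.size + 1 ≤ y.size + Polynomial.eval (csize e + (enc x).size + 1) .X
    simp; omega⟩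

/-- The list of the codes of the weakened derivations. -/
def weakenT (L : List Formula) : Tree → Tree
  | .nil => .nil
  | .node d r => .node (.node d.lft (.node (.node (consAll L d.rgt.lft.lft) d.rgt.lft.rgt)
      (weakenT L d.rgt.rgt))) (weakenT L r)
  termination_by t => t.size
  decreasing_by
    · have := d.size_rgt_le
      have := d.rgt.size_rgt_le
      simp only [Tree.size]; omega
    · simp only [Tree.size]; omega

@[fun_prop]
theorem PolyTime.weakenT {α : Type} [Coded α] {f : α → List Formula} {g : α → Tree}
    (hf : PolyTime f) (hg : PolyTime g) : PolyTime (fun x => weakenT (f x) (g x)) := by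
  refine comp' (g := fun p : List Formula × Tree => IPC.weakenT p.1 p.2) ?_ (hf.prodMk hg)
  refine forest (h := fun _ => .nil) (c := fun L d y z => .node (.node d.lft (.node
    (.node (IPC.consAll L d.rgt.lft.lft) d.rgt.lft.rgt) y)) z) (by fun_prop) (by fun_prop)
    (fun e => by rw [IPC.weakenT]) (fun e d r => by rw [IPC.weakenT]) ⟨3 * .X + 10, ?_⟩
  intro L d y z
  have := size_consAll L d.rgt.lft.lft
  have := d.size_lft_le
  have := d.size_rgt_le
  have := d.rgt.size_lft_le
  have := d.rgt.lft.size_lft_le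
  have := d.rgt.lft.size_rgt_le
  simp [Tree.size]
  omega

/-- `weakenT` works on lists, so a single derivation is wrapped as a one-element list and unwrapped
by `lft`. On a longer list it acts elementwise (`hlist`), which settles the premises of every rule
at once. -/
theorem isCode_weaken {Δ : Cedent} {L : List Formula} (hL : L.toFinset = Δ) {d : Derivation}
    {w : Tree} (h : d.IsCode w) : (d.weaken Δ).IsCode (weakenT L (.node w .nil)).lft := by
  have hs : ∀ {s : Sequent} {v : Tree}, s.IsCode v → Sequent.IsCode ⟨Δ ∪ s.ant, s.succ⟩
      (.node (consAll L v.lft) v.rgt) := by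
    intro s v h
    obtain ⟨l, hl, rfl⟩ := h.exists_list
    exact ⟨_, ⟨L ++ l, by simp [hL, hl], consAll_enc L l⟩, rfl⟩
  have hnil : weakenT L .nil = .nil := by rw [weakenT]
  have hnode : ∀ d r, weakenT L (.node d r) = .node (weakenT L (.node d .nil)).lft
      (weakenT L r) := by
    intro d r
    rw [weakenT, weakenT, Tree.lft]
  have hlist : ∀ l, weakenT L (.ofList l) =
      .ofList (l.map fun d => (weakenT L (.node d .nil)).lft) := by
    intro l
    induction l with
    | nil => exact hnil
    | cons d l ih => exact (hnode d _).trans (congrArg _ ih)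
  have hlft : ∀ l v c, (weakenT L (.node (.node l (.node v c)) .nil)).lft =
      .node l (.node (.node (consAll L v.lft) v.rgt) (weakenT L c)) := by
    intro l v c
    rw [weakenT]
    rfl
  induction d generalizing w with
  | ax s =>
    obtain ⟨v, hv, rfl⟩ := h
    exact ⟨_, hs hv, by rw [hlft, hlist]; rfl⟩
  | botAx s =>
    obtain ⟨v, hv, rfl⟩ := h
    exact ⟨_, hs hv, by rw [hlft, hlist]; rfl⟩
  | orE s d d₀ d₁ ih ih₀ ih₁ =>
    obtain ⟨v, a, a₀, a₁, hv, h, h₀, h₁, rfl⟩ := h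
    exact ⟨_, _, _, _, hs hv, ih h, ih₀ h₀, ih₁ h₁, by rw [hlft, hlist]; rfl⟩
  | orI i s d ih =>
    obtain ⟨v, a, hv, h, rfl⟩ := h
    exact ⟨_, _, hs hv, ih h, by rw [hlft, hlist]; rfl⟩
  | andE i s d ih =>
    obtain ⟨v, a, hv, h, rfl⟩ := h
    exact ⟨_, _, hs hv, ih h, by rw [hlft, hlist]; rfl⟩
  | andI s d e ih ih' =>
    obtain ⟨v, a, a', hv, h, h', rfl⟩ := h
    exact ⟨_, _, _, hs hv, ih h, ih' h', by rw [hlft, hlist]; rfl⟩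
  | impE s d e ih ih' =>
    obtain ⟨v, a, a', hv, h, h', rfl⟩ := h
    exact ⟨_, _, _, hs hv, ih h, ih' h', by rw [hlft, hlist]; rfl⟩
  | impI s d ih =>
    obtain ⟨v, a, hv, h, rfl⟩ := h
    exact ⟨_, _, hs hv, ih h, by rw [hlft, hlist]; rfl⟩

/-! ### The transformation of derivations -/

/-- For a Harrop formula there is nothing to choose. Such formulas of Γ already belong to Γ(k) and
need not be eliminated. -/
theorem Formula.choose_eq_self {φ : Formula} (h : φ.disjPos = []) (c : Pos → Bool) :
    φ.choose c = φ := by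
  induction φ generalizing c with
  | var n => rfl
  | bot => rfl
  | or a b => simp [disjPos] at h
  | and a b iha ihb =>
    simp only [disjPos, List.append_eq_nil_iff, List.map_eq_nil_iff] at h
    rw [choose, iha h.1, ihb h.2]
  | imp a b iha ihb =>
    simp only [disjPos, List.map_eq_nil_iff] at h
    rw [choose, ihb h]

theorem ChoiceData.choose_nil (E : List Occ) (k : ℕ) (γ : Formula) :
    ChoiceData.choose ((E, k.bits), γ) [] γ = γ.choose (choice E k γ) := by
  rw [choice_eq]
  rfl

/-- Given a list starting with `γ`, the rest of which is `l`, and a derivation of `γ, l, G ⇒ α`,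
eliminate `γ`. -/
def eliminate (E : List Occ) (k : List Bool) (G : Cedent) (α γ : Formula)
    (s : List Formula × Derivation) : List Formula × Derivation :=
  (s.1.tail, .detach (G ∪ s.1.tail.toFinset) γ α s.2
    (expand ((E, k), γ) [] (G ∪ s.1.tail.toFinset) γ))

/-- The code of `eliminate`. -/
def eliminateT (E : List Occ) (k : List Bool) (G : List Formula) (α γ : Formula)
    (s : List Formula × Tree) : List Formula × Tree :=
  (s.1.tail, detachT (G ++ s.1.tail) γ α s.2 (expandT ((E, k), γ) [] (G ++ s.1.tail) γ))

/-- `foldr` treats the last element of `l` first, whence the reversed list of formulas still to be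
eliminated. If `γ` occurs again further on, it merely stays in the antecedent until its last copy is
treated. -/
theorem derives_foldr_eliminate {E : List Occ} {k : ℕ} {G : Cedent} {α : Formula}
    {d : Derivation} (l m : List Formula) (hG : ∀ γ ∈ l, γ.choose (choice E k γ) ∈ G)
    (hd : d.Derives (G ∪ (l.reverse ++ m).toFinset) α) :
    (l.foldr (eliminate E k.bits G α) (l.reverse ++ m, d)).1 = m ∧
      (l.foldr (eliminate E k.bits G α) (l.reverse ++ m, d)).2.Derives (G ∪ m.toFinset) α := by
  induction l generalizing m with
  | nil => exact ⟨rfl, by simpa using hd⟩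
  | cons γ l ih =>
    have e : (γ :: l).reverse ++ m = l.reverse ++ γ :: m := by simp
    rw [e] at hd ⊢
    obtain ⟨h₁, h₂⟩ := ih (γ :: m) (fun γ' h => hG γ' (by simp [h])) hd
    rw [List.foldr_cons]
    generalize List.foldr (eliminate E k.bits G α) (l.reverse ++ γ :: m, d) l = s at h₁ h₂
    obtain ⟨l', d'⟩ := s
    subst h₁
    refine ⟨rfl, Derivation.derives_detach ?_ ?_⟩
    · simpa [Finset.union_insert] using h₂
    -- As γ(k) is already in `G`, inserting it does not change the antecedent, and γ is derived from
    -- the context alone.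
    · have := derives_expand ((E, k.bits), γ) [] (G ∪ m.toFinset) γ
      rwa [ChoiceData.choose_nil,
        Finset.insert_eq_of_mem (Finset.mem_union_left _ (hG γ (by simp)))] at this

/-- The transformed derivation `d(k)`. -/
def Instance.transform (x : Instance) : Derivation :=
  ((x.E.map Prod.fst).foldr (eliminate x.E x.k.bits x.strengthened (.or x.α₀ x.α₁))
    ((x.E.map Prod.fst).reverse, x.d.weaken x.strengthened)).2

/-- The elimination runs along `E` rather than along a list of Γ: the result must depend on the
instance and not on its code, and Γ has no canonical order while `E` is part of the instance. A
formula appears once for each of its disjunctions, which is harmless. -/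
theorem Instance.derives_transform (x : Instance) :
    x.transform.Derives x.strengthened (.or x.α₀ x.α₁) := by
  have hE := x.enumerates.2.1
  have hΓ : ∀ γ ∈ x.E.map Prod.fst, γ ∈ x.Γ := by
    intro γ h
    obtain ⟨o, ho, rfl⟩ := List.mem_map.1 h
    exact ((hE o).1 ho).1
  have hG : ∀ γ ∈ x.Γ, γ.choose (choice x.E x.k γ) ∈ x.strengthened := fun γ h =>
    Finset.mem_image_of_mem _ h
  have := (derives_foldr_eliminate (E := x.E) (k := x.k) (G := x.strengthened)
    (α := .or x.α₀ x.α₁) (d := x.d.weaken x.strengthened) (x.E.map Prod.fst) []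
    (fun γ h => hG γ (hΓ γ h)) ⟨x.derives.1.weaken _, ?_⟩).2
  · simpa [transform] using this
  · rw [Derivation.concl_weaken, x.derives.2]
    congr 1
    ext γ
    simp only [Finset.mem_union, List.append_nil, List.mem_toFinset, List.mem_reverse]
    -- Outside Γ(k), the formulas of Γ are exactly those occurring in `E`: a formula without
    -- strictly positive disjunctions equals its own γ(k).
    refine or_congr_right' fun h => ⟨fun hγ => ?_, hΓ γ⟩
    by_contra hn
    refine h ?_
    have h₀ : γ.disjPos = [] := by
      refine List.eq_nil_iff_forall_not_mem.2 fun p hp => hn ?_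
      exact List.mem_map.2 ⟨(γ, p), (hE (γ, p)).2 ⟨hγ, Formula.mem_disjPos.1 hp⟩, rfl⟩
    have := hG γ hγ
    rwa [Formula.choose_eq_self h₀] at this

theorem isCode_foldr_eliminate {E : List Occ} {k : List Bool} {G : Cedent} {L : List Formula}
    {α : Formula} {d : Derivation} {a : Tree} (hL : L.toFinset = G) (hd : d.IsCode a)
    (l m : List Formula) :
    (l.foldr (eliminateT E k L α) (m, a)).1 = (l.foldr (eliminate E k G α) (m, d)).1 ∧
    (l.foldr (eliminate E k G α) (m, d)).2.IsCode (l.foldr (eliminateT E k L α) (m, a)).2 := by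
  induction l with
  | nil => exact ⟨rfl, hd⟩
  | cons γ l ih =>
    obtain ⟨h₁, h₂⟩ := ih
    rw [List.foldr_cons, List.foldr_cons]
    generalize List.foldr (eliminate E k G α) (m, d) l = s at *
    generalize List.foldr (eliminateT E k L α) (m, a) l = t at *
    have hX : (L ++ t.1.tail).toFinset = G ∪ s.1.tail.toFinset := by
      rw [List.toFinset_append, hL, h₁]
    exact ⟨congrArg List.tail h₁,
      Derivation.isCode_detach hX h₂ (isCode_expand _ _ _ hX)⟩

/-- The code of the transformed derivation, given the code `w.1` of a derivation, its conclusion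
`w.2.1`, an enumeration and the binary digits of a number. -/
def transformT (w : Tree × (List Formula × Formula) × List Occ × List Bool) : Tree :=
  let G := w.2.1.1.map fun γ => ChoiceData.choose ((w.2.2.1, w.2.2.2), γ) [] γ
  ((w.2.2.1.map Prod.fst).foldr (eliminateT w.2.2.1 w.2.2.2 G w.2.1.2)
    ((w.2.2.1.map Prod.fst).reverse, (weakenT G (.node w.1 .nil)).lft)).2

theorem PolyTime.transformT : PolyTime transformT := by
  have hfst : PolyTime fun w : Tree × (List Formula × Formula) × List Occ × List Bool =>
      w.2.2.1.map Prod.fst := map (f := fun _ => Prod.fst) (by fun_prop) (by fun_prop)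
  have hG : PolyTime fun w : Tree × (List Formula × Formula) × List Occ × List Bool =>
      w.2.1.1.map fun γ => ChoiceData.choose ((w.2.2.1, w.2.2.2), γ) [] γ :=
    map (by fun_prop) (by fun_prop)
  have hf : PolyTime fun p : (List Formula × Formula × List Occ × List Bool) × Formula ×
      List Formula × Tree => eliminateT p.1.2.2.1 p.1.2.2.2 p.1.1 p.1.2.1 p.2.1 p.2.2 := by
    unfold eliminateT
    fun_prop
  have hX : PolyTime fun p : (List Formula × Formula × List Occ × List Bool) × Formula ×
      List Formula => IPC.expandT ((p.1.2.2.1, p.1.2.2.2), p.2.1) [] (p.1.1 ++ p.2.2.tail) p.2.1 := by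
    fun_prop
  obtain ⟨Q, hQ⟩ := hX.csize_le
  have tail_le : ∀ l : List Formula, csize l.tail ≤ csize l := fun l =>
    csize_le_of_sublist l.tail_sublist
  have key : PolyTime fun q : (List Formula × Formula × List Occ × List Bool) × List Formula ×
      List Formula × Tree => q.2.1.foldr (eliminateT q.1.2.2.1 q.1.2.2.2 q.1.1 q.1.2.1) q.2.2 := by
    -- The list of pending formulas only shrinks, and the derivation grows by an amount depending on
    -- that list but not on the derivation built so far.
    refine foldr_pair (ε := (List Formula × Formula × List Occ × List Bool) × List Formula ×
      List Formula × Tree) (f := fun q => eliminateT q.1.2.2.1 q.1.2.2.2 q.1.1 q.1.2.1)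
      (h := fun q => q.2.2) (l := fun q => q.2.1) ?_ (by fun_prop) (by fun_prop)
      ⟨.X, fun e x y => (tail_le y.1).trans (Nat.le_add_right _ _)⟩ ⟨Q + 8 * .X + 100, ?_⟩
    · exact comp' hf (f := fun p : ((List Formula × Formula × List Occ × List Bool) ×
        List Formula × List Formula × Tree) × Formula × List Formula × Tree =>
          (p.1.1, p.2.1, p.2.2)) (by fun_prop)
    · rintro ⟨⟨G, α, E, k⟩, z⟩ γ ⟨l, a⟩
      have h₁ := hQ ((G, α, E, k), γ, l)
      have h₂ := Polynomial.eval_mono_nat Q (show csize ((G, α, E, k), γ, l) ≤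
        csize (((G, α, E, k), z), γ, l) by simp only [csize_pair]; omega)
      have h₃ := csize_append G l.tail
      have h₄ := tail_le l
      simp only [csize_tree, Polynomial.eval_add, Polynomial.eval_mul, Polynomial.eval_X,
        Polynomial.eval_ofNat, eliminateT, size_detachT, csize_pair] at *
      omega
  have := comp' key (f := fun w : Tree × (List Formula × Formula) × List Occ × List Bool =>
    ((w.2.1.1.map fun γ => ChoiceData.choose ((w.2.2.1, w.2.2.2), γ) [] γ, w.2.1.2, w.2.2.1,
      w.2.2.2), w.2.2.1.map Prod.fst, (w.2.2.1.map Prod.fst).reverse,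
        (IPC.weakenT (w.2.1.1.map fun γ => ChoiceData.choose ((w.2.2.1, w.2.2.2), γ) [] γ)
          (.node w.1 .nil)).lft)) (by fun_prop)
  exact this.snd'

theorem Instance.isCode_transform (x : Instance) {a : Tree} (ha : x.d.IsCode a)
    {l : List Formula} (hl : l.toFinset = x.Γ) :
    x.transform.IsCode (transformT (a, (l, .or x.α₀ x.α₁), x.E, x.k.bits)) := by
  have hG : (l.map fun γ => ChoiceData.choose ((x.E, x.k.bits), γ) [] γ).toFinset =
      x.strengthened := by
    ext β
    simp only [ChoiceData.choose_nil, List.mem_toFinset, List.mem_map, strengthened,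
      Cedent.strengthen, Finset.mem_image, ← hl]
  exact (isCode_foldr_eliminate hG (isCode_weaken hG ha) _ _).2

theorem isPolyTimeTransformation_transform : IsPolyTimeTransformation Instance.transform := by
  refine ⟨Instance.derives_transform, ?_⟩
  -- The sequent Γ ⇒ α₀ ∨ α₁ is read off the last inference of the given derivation.
  have h : PolyTime fun w : Tree => (w.lft, w.lft.rgt.lft, w.rgt) := by fun_prop
  obtain ⟨p, B, hp⟩ := PolyTime.transformT.comp_enc h
  refine ⟨p, B, ?_⟩
  rintro x _ ⟨a, ha, rfl⟩
  obtain ⟨l, hl, hw⟩ := ha.concl.exists_list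
  rw [x.derives.2] at hl hw
  obtain ⟨t, ht, ht'⟩ := hp p (.node a (.node (enumCode x.E) (.ofNat x.k)))
    (a, (l, .or x.α₀ x.α₁), x.E, x.k.bits) (by
      change Tree.node a (.node a.rgt.lft _) = _
      rw [hw]
      rfl)
  exact ⟨_, _, t, rfl, x.isCode_transform ha hl, ht, ht'⟩

/-! ### The sequents of a derivation -/

/-- A sequent given by the list of the formulas of its antecedent. -/
abbrev ListSequent : Type := List Formula × Formula

def ListSequent.toSequent (r : ListSequent) : Sequent := ⟨r.1.toFinset, r.2⟩

/-- The list of the codes of the sequents in a list of codes of derivations. -/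
def sequentsT : Tree → List Tree
  | .nil => []
  | .node d r => d.rgt.lft :: (sequentsT d.rgt.rgt ++ sequentsT r)
  termination_by t => t.size
  decreasing_by
    · have := d.size_rgt_le
      have := d.rgt.size_rgt_le
      simp only [Tree.size]; omega
    · simp only [Tree.size]; omega

@[fun_prop]
theorem PolyTime.sequentsT {α : Type} [Coded α] {f : α → Tree} (hf : PolyTime f) :
    PolyTime (fun x => sequentsT (f x)) := by
  have : PolyTime fun p : Tree × Tree => IPC.sequentsT p.2 := by
    refine forest (F := fun _ t => IPC.sequentsT t) (h := fun _ => [])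
      (c := fun _ d y z => d.rgt.lft :: (y ++ z)) (by fun_prop) (by fun_prop)
      (fun e => by rw [IPC.sequentsT]) (fun e d r => by rw [IPC.sequentsT]) ⟨.X, ?_⟩
    intro e d y z
    have := csize_append y z
    have := d.size_rgt_le
    have := d.rgt.size_lft_le
    simp
    omega
  exact comp' (g := fun p : Tree × Tree => IPC.sequentsT p.2) this (hf.prodMk hf)

/-- The trees in the list `l` code the sequents of the set `S`. -/
def CodesSequents (S : Set Sequent) (l : List Tree) : Prop :=
  ∃ L : List ListSequent, L.map enc = l ∧ ∀ s, s ∈ S ↔ ∃ r ∈ L, r.toSequent = s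

theorem CodesSequents.union {S S' : Set Sequent} {l l' : List Tree} (h : CodesSequents S l)
    (h' : CodesSequents S' l') : CodesSequents (S ∪ S') (l ++ l') := by
  obtain ⟨L, rfl, h⟩ := h
  obtain ⟨L', rfl, h'⟩ := h'
  refine ⟨L ++ L', List.map_append, fun s => ?_⟩
  rw [Set.mem_union, h, h']
  simp only [List.mem_append, or_and_right, exists_or]

theorem Sequent.IsCode.codesSequents {s : Sequent} {v : Tree} (h : s.IsCode v) :
    CodesSequents {s} [v] := by
  obtain ⟨l, hl, rfl⟩ := h.exists_list
  refine ⟨[(l, s.succ)], rfl, fun s' => ?_⟩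
  have e : ListSequent.toSequent (l, s.succ) = s := by rw [ListSequent.toSequent, hl]
  simp only [Set.mem_singleton_iff, List.mem_singleton, exists_eq_left, e]
  exact eq_comm

theorem Derivation.IsCode.codesSequents {d : Derivation} {w : Tree} (h : d.IsCode w) :
    CodesSequents d.sequents (sequentsT (.node w .nil)) := by
  have hnil : sequentsT .nil = [] := by rw [sequentsT]
  have hlist : ∀ l, sequentsT (.ofList l) = (l.map fun a => sequentsT (.node a .nil)).flatten := by
    intro l
    induction l with
    | nil => exact hnil
    | cons a l ih =>
      rw [Tree.ofList, sequentsT, ih, List.map_cons, List.flatten_cons, sequentsT, hnil]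
      simp
  have hnode : ∀ i v l, sequentsT (.node (.node i (.node v (.ofList l))) .nil) =
      [v] ++ (l.map fun a => sequentsT (.node a .nil)).flatten := by
    intro i v l
    rw [sequentsT, hnil]
    simp only [Tree.rgt, Tree.lft, hlist]
    simp
  induction d generalizing w with
  | ax s =>
    obtain ⟨v, hv, rfl⟩ := h
    simpa [hnode, sequents] using hv.codesSequents
  | botAx s =>
    obtain ⟨v, hv, rfl⟩ := h
    simpa [hnode, sequents] using hv.codesSequents
  | orE s d d₀ d₁ ih ih₀ ih₁ =>
    obtain ⟨v, a, a₀, a₁, hv, h, h₀, h₁, rfl⟩ := h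
    simpa [hnode, sequents] using
      ((hv.codesSequents.union (ih h)).union (ih₀ h₀)).union (ih₁ h₁)
  | orI i s d ih =>
    obtain ⟨v, a, hv, h, rfl⟩ := h
    simpa [hnode, sequents] using hv.codesSequents.union (ih h)
  | andE i s d ih =>
    obtain ⟨v, a, hv, h, rfl⟩ := h
    simpa [hnode, sequents] using hv.codesSequents.union (ih h)
  | andI s d e ih ih' =>
    obtain ⟨v, a, a', hv, h, h', rfl⟩ := h
    simpa [hnode, sequents] using (hv.codesSequents.union (ih h)).union (ih' h')
  | impE s d e ih ih' =>
    obtain ⟨v, a, a', hv, h, h', rfl⟩ := h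
    simpa [hnode, sequents] using (hv.codesSequents.union (ih h)).union (ih' h')
  | impI s d ih =>
    obtain ⟨v, a, hv, h, rfl⟩ := h
    simpa [hnode, sequents] using hv.codesSequents.union (ih h)

/-! ### The disjunction property -/

/-- Realizability of formulas, relative to a cedent `G` and a set `D` of derived formulas. -/
def Formula.Realized (G : Cedent) (D : Set Formula) : Formula → Prop
  | .var _ => True
  | .bot => True
  | .or a b => (a ∈ D ∧ a.Realized G D) ∨ (b ∈ D ∧ b.Realized G D)
  | .and a b => (a ∈ G ∨ a ∈ D → a.Realized G D) ∧ (b ∈ G ∨ b ∈ D → b.Realized G D)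
  | .imp a b => (a ∈ G ∨ a ∈ D) ∧ a.Realized G D → (b ∈ G ∨ b ∈ D) → b.Realized G D

/-- Only the clause for disjunctions makes a demand, and in a Harrop formula it is reached at most
in antecedents of implications, where it is a hypothesis. This holds for any `G` and `D`. -/
theorem Formula.realized_of_disjPos {G : Cedent} {D : Set Formula} {φ : Formula}
    (h : φ.disjPos = []) : φ.Realized G D := by
  induction φ with
  | var n => trivial
  | bot => trivial
  | or a b => simp [disjPos] at h
  | and a b iha ihb =>
    simp only [disjPos, List.append_eq_nil_iff, List.map_eq_nil_iff] at h
    exact ⟨fun _ => iha h.1, fun _ => ihb h.2⟩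
  | imp a b iha ihb =>
    simp only [disjPos, List.map_eq_nil_iff] at h
    exact fun _ _ => ihb h

/-- The reason for passing to Γ(k): all its formulas are Harrop formulas, hence realized. -/
theorem Formula.disjPos_choose (φ : Formula) (c : Pos → Bool) : (φ.choose c).disjPos = [] := by
  induction φ generalizing c with
  | var n => rfl
  | bot => rfl
  | or a b iha ihb =>
    rw [choose]
    split
    · exact ihb _
    · exact iha _
  | and a b iha ihb => simp [choose, disjPos, iha, ihb]
  | imp a b iha ihb => simp [choose, disjPos, ihb]

theorem Derivation.concl_mem_sequents (d : Derivation) : d.concl ∈ d.sequents := by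
  cases d <;> simp [concl, sequents]

/-- The sequents of a derivation preserve realizability, if they do not lead outside the derived
formulas. -/
theorem Derivation.Correct.realized {G : Cedent} {D : Set Formula} {d : Derivation}
    (hd : d.Correct)
    (hD : ∀ s ∈ d.sequents, (∀ φ ∈ s.ant, φ ∈ G ∨ φ ∈ D) → s.succ ∈ D)
    (hant : ∀ φ ∈ d.concl.ant, (φ ∈ G ∨ φ ∈ D) ∧ φ.Realized G D) :
    d.concl.succ.Realized G D := by
  -- Stated for any derivation whose sequents occur in `d`, so that it passes to the premises in the
  -- induction.
  have sub : ∀ {d' : Derivation} {φ : Formula}, d'.concl.succ = φ → d'.sequents ⊆ d.sequents →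
      (∀ φ ∈ d'.concl.ant, (φ ∈ G ∨ φ ∈ D) ∧ φ.Realized G D) → φ ∈ D := by
    rintro d' _ rfl hs h
    exact hD _ (hs d'.concl_mem_sequents) fun φ hφ => (h φ hφ).1
  have ins : ∀ {α φ : Formula} {X : Cedent}, (α ∈ G ∨ α ∈ D) ∧ α.Realized G D →
      (∀ φ ∈ X, (φ ∈ G ∨ φ ∈ D) ∧ φ.Realized G D) → φ ∈ insert α X →
      (φ ∈ G ∨ φ ∈ D) ∧ φ.Realized G D := by
    intro α φ X hα hX hφ
    rcases Finset.mem_insert.1 hφ with rfl | hφ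
    · exact hα
    · exact hX _ hφ
  induction d with
  | ax s => exact (hant _ hd).2
  | botAx s =>
    -- The restriction of the ⊥-axiom to atoms is used here: ⊥ counts as realized, which would not
    -- justify a disjunction as succedent.
    obtain ⟨_, n, h⟩ := hd
    change s.succ.Realized G D
    rw [h]
    trivial
  | orE s d d₀ d₁ ih ih₀ ih₁ =>
    obtain ⟨⟨α₀, α₁, h, h₀, h₁⟩, k, k₀, k₁⟩ := hd
    have s' : d.sequents ⊆ (orE s d d₀ d₁).sequents := fun _ h => .inl (.inl (.inr h))
    have s₀ : d₀.sequents ⊆ (orE s d d₀ d₁).sequents := fun _ h => .inl (.inr h)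
    have s₁ : d₁.sequents ⊆ (orE s d d₀ d₁).sequents := fun _ h => .inr h
    have r := ih k (fun _ h => hD _ (s' h)) (by rw [h]; exact hant)
      (fun e hs => sub e (hs.trans s'))
    rw [h] at r
    -- The realized disjunct lies in `D`, so the antecedent of the corresponding minor premise is
    -- available and realized.
    rcases r with ⟨m, r⟩ | ⟨m, r⟩
    · have := ih₀ k₀ (fun _ h => hD _ (s₀ h)) (by
        rw [h₀]; exact fun φ => ins ⟨.inr m, r⟩ hant) (fun e hs => sub e (hs.trans s₀))
      rwa [h₀] at this
    · have := ih₁ k₁ (fun _ h => hD _ (s₁ h)) (by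
        rw [h₁]; exact fun φ => ins ⟨.inr m, r⟩ hant) (fun e hs => sub e (hs.trans s₁))
      rwa [h₁] at this
  | orI i s d ih =>
    obtain ⟨⟨α₀, α₁, h, h₀⟩, k⟩ := hd
    have s' : d.sequents ⊆ (orI i s d).sequents := fun _ h => .inr h
    have r := ih k (fun _ h => hD _ (s' h)) (by rw [h₀]; exact hant)
      (fun e hs => sub e (hs.trans s'))
    -- The premise is itself a sequent of the derivation, so its succedent is in `D` and not merely
    -- in `G`. The clause for ∨ insists on `D` because the final cut-deduction needs a sequent to
    -- start from.
    have m := sub (d' := d) rfl s' (by rw [h₀]; exact hant)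
    rw [h₀] at r m
    change s.succ.Realized G D
    rw [h]
    cases i
    · exact .inl ⟨m, r⟩
    · exact .inr ⟨m, r⟩
  | andE i s d ih =>
    obtain ⟨⟨α₀, α₁, h₀, h⟩, k⟩ := hd
    have s' : d.sequents ⊆ (andE i s d).sequents := fun _ h => .inr h
    have r := ih k (fun _ h => hD _ (s' h)) (by rw [h₀]; exact hant)
      (fun e hs => sub e (hs.trans s'))
    have m := sub (d' := andE i s d) rfl subset_rfl hant
    change s.succ ∈ D at m
    change s.succ.Realized G D
    rw [h₀] at r
    rw [h] at m ⊢
    cases i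
    -- The set `D` is closed only under the sequents at hand, so the clause for ∧ is conditional on
    -- the component being available; the conclusion of the inference supplies this condition.
    · exact r.1 (.inr m)
    · exact r.2 (.inr m)
  | andI s d e ih ih' =>
    obtain ⟨⟨α₀, α₁, h, h₀, h₁⟩, k, k'⟩ := hd
    have s₀ : d.sequents ⊆ (andI s d e).sequents := fun _ h => .inl (.inr h)
    have s₁ : e.sequents ⊆ (andI s d e).sequents := fun _ h => .inr h
    have r := ih k (fun _ h => hD _ (s₀ h)) (by rw [h₀]; exact hant)
      (fun e hs => sub e (hs.trans s₀))
    have r' := ih' k' (fun _ h => hD _ (s₁ h)) (by rw [h₁]; exact hant)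
      (fun e hs => sub e (hs.trans s₁))
    rw [h₀] at r
    rw [h₁] at r'
    change s.succ.Realized G D
    rw [h]
    exact ⟨fun _ => r, fun _ => r'⟩
  | impE s d e ih ih' =>
    obtain ⟨⟨α, h₀, h₁⟩, k, k'⟩ := hd
    have s₀ : d.sequents ⊆ (impE s d e).sequents := fun _ h => .inl (.inr h)
    have s₁ : e.sequents ⊆ (impE s d e).sequents := fun _ h => .inr h
    have r := ih k (fun _ h => hD _ (s₀ h)) (by rw [h₀]; exact hant)
      (fun e hs => sub e (hs.trans s₀))
    have r' := ih' k' (fun _ h => hD _ (s₁ h)) (by rw [h₁]; exact hant)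
      (fun e hs => sub e (hs.trans s₁))
    have m := sub (d' := e) rfl s₁ (by rw [h₁]; exact hant)
    rw [h₀] at r
    rw [h₁] at r' m
    -- The premise for `α` and the conclusion, both sequents of the derivation, supply the
    -- membership conditions in the clause for ⊃.
    exact r ⟨.inr m, r'⟩ (.inr (sub (d' := impE s d e) rfl subset_rfl hant))
  | impI s d ih =>
    obtain ⟨⟨α, β, h, h₀⟩, k⟩ := hd
    have s' : d.sequents ⊆ (impI s d).sequents := fun _ h => .inr h
    change s.succ.Realized G D
    rw [h]
    intro hα _
    have := ih k (fun _ h => hD _ (s' h)) (by rw [h₀]; exact fun φ => ins hα hant)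
      (fun e hs => sub e (hs.trans s'))
    rwa [h₀] at this

/-! ### Forward chaining -/

/-- The formulas of the antecedent belong to `G` or have been derived by the sequents in `F`. -/
def fires (G : List Formula) (F : List ListSequent) (r : ListSequent) : Bool :=
  r.1.all fun φ => memb φ (G ++ F.map Prod.snd)

theorem fires_iff {G : List Formula} {F : List ListSequent} {r : ListSequent} :
    fires G F r = true ↔ ∀ φ ∈ r.1, φ ∈ G ∨ φ ∈ F.map Prod.snd := by
  simp only [fires, List.all_eq_true, memb_iff, List.mem_append]

/-- Add all the sequents that fire. -/
def chainStep (G : List Formula) (L F : List ListSequent) : List ListSequent :=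
  F ++ L.filter (fires G F)

/-- The sequents of `L` that fire, in the order of their firing. -/
def saturate (G : List Formula) (L : List ListSequent) : List ListSequent :=
  L.foldr (fun _ F => chainStep G L F) []

@[fun_prop]
theorem PolyTime.saturate {α : Type} [Coded α] {G : α → List Formula}
    {L : α → List ListSequent} (hG : PolyTime G) (hL : PolyTime L) :
    PolyTime (fun x => saturate (G x) (L x)) := by
  refine comp' (g := fun p : List Formula × List ListSequent => IPC.saturate p.1 p.2) ?_
    (f := fun x => (G x, L x)) (by fun_prop)
  have h₁ : PolyTime fun p : (List Formula × List ListSequent) × ListSequent =>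
      p.1.2.map Prod.snd := map (f := fun _ => Prod.snd) (by fun_prop) (by fun_prop)
  have h₂ : PolyTime fun p : (List Formula × List ListSequent) × ListSequent =>
      fires p.1.1 p.1.2 p.2 := by
    have : PolyTime fun p : ((List Formula × List ListSequent) × ListSequent) × Formula =>
        p.1.1.2.map Prod.snd := comp' h₁ (f := Prod.fst) (by fun_prop)
    exact all (f := fun (p : (List Formula × List ListSequent) × ListSequent) φ =>
      IPC.memb φ (p.1.1 ++ p.1.2.map Prod.snd)) (by fun_prop) (by fun_prop)
  have h₃ : PolyTime fun p : (List Formula × List ListSequent) × ListSequent ×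
      List ListSequent => p.1.2.filter (fires p.1.1 p.2.2) :=
    filter (f := fun (p : (List Formula × List ListSequent) × ListSequent ×
      List ListSequent) r => fires p.1.1 p.2.2 r)
      (comp' h₂ (f := fun q : ((List Formula × List ListSequent) × ListSequent ×
        List ListSequent) × ListSequent => ((q.1.1.1, q.1.2.2), q.2)) (by fun_prop))
      (by fun_prop)
  -- A round may repeat sequents that fired before, but appends only a sublist of `L`, so the growth
  -- per round is bounded by the size of `L`.
  refine foldr (ε := List Formula × List ListSequent) (f := fun p _ F => chainStep p.1 p.2 F)
    (h := fun _ => []) (l := fun p => p.2) ?_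
    (by fun_prop) (by fun_prop) ⟨.X, ?_⟩
  · unfold chainStep
    fun_prop
  · rintro ⟨G, L⟩ r F
    have h₁ := csize_append F (L.filter (fires G F))
    have h₂ := csize_le_of_sublist (List.filter_sublist (l := L) (p := fires G F))
    simp only [chainStep, csize_pair, Polynomial.eval_X] at *
    omega

/-- Lists of sequents of `L` each of which fires after the preceding ones. -/
inductive Chain (G : List Formula) (L : List ListSequent) : List ListSequent → Prop
  | nil : Chain G L []
  | snoc {F : List ListSequent} {r : ListSequent} (hF : Chain G L F) (hr : r ∈ L)
      (h : ∀ φ ∈ r.1, φ ∈ G ∨ φ ∈ F.map Prod.snd) : Chain G L (F ++ [r])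

theorem Chain.append {G : List Formula} {L F : List ListSequent} (hF : Chain G L F)
    (l : List ListSequent) (hl : ∀ r ∈ l, r ∈ L ∧ ∀ φ ∈ r.1, φ ∈ G ∨ φ ∈ F.map Prod.snd) :
    Chain G L (F ++ l) := by
  induction l generalizing F with
  | nil => simpa using hF
  | cons r l ih =>
    obtain ⟨h₁, h₂⟩ := hl r (by simp)
    have := ih (hF.snoc h₁ h₂) fun r' h' => by
      obtain ⟨h₃, h₄⟩ := hl r' (by simp [h'])
      refine ⟨h₃, fun φ hφ => (h₄ φ hφ).imp_right fun h => ?_⟩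
      rw [List.map_append]
      exact List.mem_append_left _ h
    simpa using this

/-- The sequents added in one round rely only on those of the preceding rounds, so their order
within the round is irrelevant. -/
theorem chain_saturate (G : List Formula) (L : List ListSequent) : Chain G L (saturate G L) := by
  suffices h : ∀ l : List ListSequent, Chain G L (l.foldr (fun _ F => chainStep G L F) []) from h L
  intro l
  induction l with
  | nil => exact .nil
  | cons a l ih =>
    refine ih.append _ fun r hr => ?_
    rw [List.mem_filter, fires_iff] at hr
    exact hr

/-- Each round before saturation gives at least one more sequent of `L` a derived succedent, so as
many rounds as `L` has entries suffice. -/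
theorem mem_saturate {G : List Formula} {L : List ListSequent} {r : ListSequent} (hr : r ∈ L)
    (h : fires G (saturate G L) r = true) : r.2 ∈ (saturate G L).map Prod.snd := by
  let Sat : List ListSequent → Prop := fun F =>
    ∀ r ∈ L, fires G F r = true → r.2 ∈ F.map Prod.snd
  let S : List ListSequent → Finset ListSequent := fun F =>
    L.toFinset.filter fun r => r.2 ∈ F.map Prod.snd
  have key : ∀ l : List ListSequent, Sat (l.foldr (fun _ F => chainStep G L F) []) ∨
      l.length ≤ (S (l.foldr (fun _ F => chainStep G L F) [])).card := by
    intro l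
    induction l with
    | nil => exact .inr (Nat.zero_le _)
    | cons a l ih =>
      rw [List.foldr_cons]
      generalize List.foldr (fun _ F => chainStep G L F) [] l = F at ih ⊢
      -- Saturation persists, because a further round adds only succedents already present; without
      -- it, a sequent that fires with a new succedent makes the count strictly larger.
      by_cases hs : Sat F
      · left
        have hsub : ∀ φ ∈ (chainStep G L F).map Prod.snd, φ ∈ F.map Prod.snd := by
          intro φ hφ
          rw [chainStep, List.map_append, List.mem_append] at hφ
          rcases hφ with hφ | hφ
          · exact hφ
          · obtain ⟨r, hr, rfl⟩ := List.mem_map.1 hφ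
            rw [List.mem_filter] at hr
            exact hs r hr.1 hr.2
        intro r hr h
        have h' : fires G F r = true := fires_iff.2 fun φ hφ =>
          (fires_iff.1 h φ hφ).imp_right (hsub φ)
        rw [chainStep, List.map_append]
        exact List.mem_append_left _ (hs r hr h')
      · right
        have hc := ih.resolve_left hs
        simp only [Sat, not_forall] at hs
        obtain ⟨r, hr, hf, hn⟩ := hs
        rw [List.length_cons]
        refine Nat.lt_of_le_of_lt hc (Finset.card_lt_card ?_)
        rw [Finset.ssubset_iff_of_subset]
        · refine ⟨r, ?_, fun h => hn (Finset.mem_filter.1 h).2⟩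
          refine Finset.mem_filter.2 ⟨List.mem_toFinset.2 hr, ?_⟩
          exact List.mem_map_of_mem (List.mem_append_right _ (List.mem_filter.2 ⟨hr, hf⟩))
        · intro r' h'
          rw [Finset.mem_filter] at h' ⊢
          refine ⟨h'.1, ?_⟩
          rw [chainStep, List.map_append]
          exact List.mem_append_left _ h'.2
  rcases key L with hs | hc
  · exact hs r hr h
  -- If the count has reached the length of `L`, all succedents are derived.
  · have hS : S (saturate G L) = L.toFinset := Finset.eq_of_subset_of_card_le
      (Finset.filter_subset _ _) ((List.toFinset_card_le L).trans hc)
    have : r ∈ S (saturate G L) := hS ▸ List.mem_toFinset.2 hr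
    exact (Finset.mem_filter.1 this).2

/-! ### Cut-deductions -/

/-- Cut the succedent of `r` out of the antecedent `s.1` of a cut-deduction of `s.1 ⇒ α` with the
code `s.2`. -/
def cutStep (α : Formula) (r : ListSequent) (s : List Formula × Tree) : List Formula × Tree :=
  bif memb r.2 s.1 then
    (r.1 ++ s.1.filter (fun φ => !eqb φ r.2),
      inferT 1 (r.1 ++ s.1.filter (fun φ => !eqb φ r.2)) α [inferT 0 r.1 r.2 [], s.2])
  else s

/-- `w` codes a cut-deduction of `l ⇒ α` from `S`. -/
def CutDeducible (S : Set Sequent) (l : List Formula) (α : Formula) (w : Tree) : Prop :=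
  ∃ d : CutDeduction, d.IsCode w ∧ d.CorrectFrom S ∧ d.concl = ⟨l.toFinset, α⟩

theorem cutDeducible_start {S : Set Sequent} {r : ListSequent} (h : r.toSequent ∈ S) :
    CutDeducible S r.1 r.2 (inferT 0 r.1 r.2 []) :=
  ⟨.start r.toSequent, ⟨_, ⟨_, ⟨r.1, rfl, rfl⟩, rfl⟩, rfl⟩, h, rfl⟩

theorem cutDeducible_cutStep {S : Set Sequent} {α : Formula} {r : ListSequent}
    {s : List Formula × Tree} (hr : r.toSequent ∈ S) (hs : CutDeducible S s.1 α s.2) :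
    CutDeducible S (cutStep α r s).1 α (cutStep α r s).2 := by
  rw [cutStep]
  cases h : memb r.2 s.1 with
  | false => exact hs
  | true =>
    obtain ⟨d, h₁, h₂, h₃⟩ := cutDeducible_start hr
    obtain ⟨e, k₁, k₂, k₃⟩ := hs
    -- The cut formula is `r.2` and `Δ` is `s.1` without it; reinserting it gives back `s.1`, as it
    -- is a member.
    refine ⟨.cut ⟨r.1.toFinset ∪ (s.1.filter fun φ => !eqb φ r.2).toFinset, α⟩ d e,
      ⟨_, _, _, ⟨_, ⟨r.1 ++ s.1.filter fun φ => !eqb φ r.2, by simp, rfl⟩, rfl⟩, h₁, k₁, rfl⟩,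
      ⟨⟨r.1.toFinset, (s.1.filter fun φ => !eqb φ r.2).toFinset, r.2, α, h₃, ?_, rfl⟩, h₂, k₂⟩, ?_⟩
    · rw [k₃]
      congr 1
      ext φ
      rw [memb_iff] at h
      simp only [List.mem_toFinset, Finset.mem_insert, List.mem_filter, Bool.not_eq_true',
        Bool.eq_false_iff, ne_eq, eqb_iff]
      by_cases hφ : φ = r.2
      · simp [hφ, h]
      · simp [hφ]
    · simp [CutDeduction.concl]

/-- The latest sequent is cut first. This replaces its succedent by formulas from `G` or derived
strictly earlier, so the formula does not have to be cut again for that entry; when the chain is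
used up, only formulas of `G` remain. Thus every entry costs at most one cut, whereas unfolding the
dependencies into a tree could be exponential. -/
theorem Chain.cutDeducible_foldr {S : Set Sequent} {G : List Formula} {L F : List ListSequent}
    (hF : Chain G L F) (hL : ∀ r ∈ L, r.toSequent ∈ S) {α : Formula} {s : List Formula × Tree}
    (hs : CutDeducible S s.1 α s.2) (hG : ∀ φ ∈ s.1, φ ∈ G ∨ φ ∈ F.map Prod.snd) :
    CutDeducible S (F.foldr (cutStep α) s).1 α (F.foldr (cutStep α) s).2 ∧
      ∀ φ ∈ (F.foldr (cutStep α) s).1, φ ∈ G := by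
  induction hF generalizing s with
  | nil => exact ⟨hs, fun φ hφ => by simpa using hG φ hφ⟩
  | snoc hF hr h ih =>
    rename_i F r
    rw [List.foldr_append]
    refine ih (cutDeducible_cutStep (hL r hr) hs) fun φ hφ => ?_
    simp only [List.map_append, List.mem_append, List.map_cons, List.map_nil,
      List.mem_singleton] at hG
    rw [List.foldr_cons, List.foldr_nil, cutStep] at hφ
    cases hm : memb r.2 s.1 <;> rw [hm] at hφ
    · rcases hG φ hφ with h₁ | h₁ | rfl
      · exact .inl h₁
      · exact .inr h₁
      · rw [← Bool.not_eq_true, memb_iff] at hm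
        exact absurd hφ hm
    · simp only [cond_true, List.mem_append, List.mem_filter, Bool.not_eq_true',
        Bool.eq_false_iff, ne_eq, eqb_iff] at hφ
      rcases hφ with hφ | ⟨hφ, hne⟩
      · exact h φ hφ
      · rcases hG φ hφ with h₁ | h₁ | h₁
        · exact .inl h₁
        · exact .inr h₁
        · exact absurd h₁ hne

/-! ### Finding the disjunct -/

/-- A sequent with the succedent `α`, if there is one. -/
def pick (F : List ListSequent) (α : Formula) : ListSequent :=
  (F.filter fun r => eqb r.2 α).headD ([], α)

theorem pick_snd (F : List ListSequent) (α : Formula) : (pick F α).2 = α := by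
  rw [pick]
  cases h : F.filter fun r => eqb r.2 α with
  | nil => rfl
  | cons r l =>
    have : r ∈ F.filter fun r => eqb r.2 α := by rw [h]; simp
    exact eqb_iff.1 (List.mem_filter.1 this).2

theorem pick_mem {F : List ListSequent} {α : Formula} (h : α ∈ F.map Prod.snd) :
    pick F α ∈ F := by
  obtain ⟨r, hr, rfl⟩ := List.mem_map.1 h
  have hr' : r ∈ F.filter fun r' => eqb r'.2 r.2 := List.mem_filter.2 ⟨hr, eqb_iff.2 rfl⟩
  rw [pick]
  cases h : F.filter fun r' => eqb r'.2 r.2 with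
  | nil => rw [h] at hr'; simp at hr'
  | cons r' l =>
    have : r' ∈ F.filter fun r' => eqb r'.2 r.2 := by rw [h]; simp
    exact (List.mem_filter.1 this).1

theorem PolyTime.foldr_cutStep : PolyTime fun p : List ListSequent × Formula × List Formula × Tree =>
    p.1.foldr (cutStep p.2.1) p.2.2 := by
  have hfilter : PolyTime fun q : (List ListSequent × Formula × List Formula × Tree) ×
      ListSequent × List Formula × Tree => q.2.2.1.filter fun φ => !IPC.eqb φ q.2.1.2 :=
    filter (by fun_prop) (by fun_prop)
  -- The antecedent grows by at most the size of the sequent cut in; the deduction grows by an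
  -- amount linear in that sequent, the current antecedent and `α`.
  refine foldr_pair (ε := List ListSequent × Formula × List Formula × Tree)
    (f := fun p => cutStep p.2.1) (h := fun p => p.2.2) (l := fun p => p.1) ?_ (by fun_prop) (by fun_prop) ⟨.X, ?_⟩ ⟨5 * .X + 50, ?_⟩
  · unfold cutStep
    fun_prop
  · rintro ⟨F, α, z⟩ ⟨m, β⟩ ⟨l, a⟩
    have h₁ := csize_append m (l.filter fun φ => !IPC.eqb φ β)
    have h₂ := csize_le_of_sublist (List.filter_sublist (l := l) (p := fun φ => !IPC.eqb φ β))
    rw [cutStep]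
    cases IPC.memb (m, β).2 (l, a).1 <;>
      simp only [cond_true, cond_false, csize_pair, Polynomial.eval_X] <;> omega
  · rintro ⟨F, α, z⟩ ⟨m, β⟩ ⟨l, a⟩
    have h₁ := csize_append m (l.filter fun φ => !IPC.eqb φ β)
    have h₂ := csize_le_of_sublist (List.filter_sublist (l := l) (p := fun φ => !IPC.eqb φ β))
    rw [cutStep]
    cases IPC.memb (m, β).2 (l, a).1 <;>
      simp only [cond_true, cond_false, csize_pair, csize_tree, csize_cons, csize_nil, size_inferT,
        Polynomial.eval_add, Polynomial.eval_mul, Polynomial.eval_X, Polynomial.eval_ofNat] <;>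
      omega

@[fun_prop]
theorem PolyTime.pick {α : Type} [Coded α] {F : α → List ListSequent} {φ : α → Formula}
    (hF : PolyTime F) (hφ : PolyTime φ) : PolyTime (fun x => pick (F x) (φ x)) := by
  refine comp' (g := fun p : List ListSequent × Formula => IPC.pick p.1 p.2) ?_ (hF.prodMk hφ)
  have : PolyTime fun p : List ListSequent × Formula => p.1.filter fun r => IPC.eqb r.2 p.2 :=
    filter (by fun_prop) (by fun_prop)
  unfold IPC.pick
  fun_prop

/-- The code of a cut-deduction with the succedent `α` from the sequents in `F`, given in the order
of their firing. -/
def cutDown (F : List ListSequent) (α : Formula) : Tree :=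
  (F.foldr (cutStep α) ((pick F α).1, inferT 0 (pick F α).1 α [])).2

@[fun_prop]
theorem PolyTime.cutDown {α : Type} [Coded α] {F : α → List ListSequent} {φ : α → Formula}
    (hF : PolyTime F) (hφ : PolyTime φ) : PolyTime (fun x => cutDown (F x) (φ x)) :=
  snd' (comp' foldr_cutStep (f := fun x => (F x, φ x, (IPC.pick (F x) (φ x)).1,
    IPC.inferT 0 (IPC.pick (F x) (φ x)).1 (φ x) [])) (by fun_prop))

/-- The index of a derived disjunct of `φ`: the left one is preferred. -/
def disjunctIndex (F : List ListSequent) (φ : Formula) : Bool := !memb φ.fst (F.map Prod.snd)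

@[fun_prop]
theorem PolyTime.disjunctIndex {α : Type} [Coded α] {F : α → List ListSequent} {φ : α → Formula}
    (hF : PolyTime F) (hφ : PolyTime φ) : PolyTime (fun x => disjunctIndex (F x) (φ x)) := by
  have : PolyTime fun x => (F x).map Prod.snd := map (f := fun _ => Prod.snd) (by fun_prop) hF
  unfold IPC.disjunctIndex
  fun_prop

/-- The index of a derived disjunct of `φ`, and the code of a cut-deduction of it from the sequents
in `L`, where `G` is the list of the assumptions. -/
def disjunct (L : List ListSequent) (G : List Formula) (φ : Formula) : Bool × Tree :=
  (disjunctIndex (saturate G L) φ, cutDown (saturate G L)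
    (bif disjunctIndex (saturate G L) φ then φ.snd else φ.fst))

theorem PolyTime.disjunct : PolyTime fun p : List ListSequent × List Formula × Formula =>
    disjunct p.1 p.2.1 p.2.2 := by
  unfold IPC.disjunct
  fun_prop

/-- Realizability is applied with `D` the succedents of the saturation: closure of `D` is
saturation, and the antecedent is realized since it consists of Harrop formulas. -/
theorem Instance.isSolution_disjunct (x : Instance) {e : Derivation}
    (he : e.Derives x.strengthened (.or x.α₀ x.α₁)) {L : List ListSequent}
    (hL : ∀ s, s ∈ e.sequents ↔ ∃ r ∈ L, r.toSequent = s) {G : List Formula}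
    (hG : G.toFinset = x.strengthened) :
    ∃ y, x.IsSolution e y ∧ solutionIsCode y (enc (disjunct L G (.or x.α₀ x.α₁))) := by
  have hr := he.1.realized (G := G.toFinset) (D := {φ | φ ∈ (saturate G L).map Prod.snd})
    (fun s hs hφ => ?_) (fun φ hφ => ?_)
  · rw [he.2] at hr
    have hL' : ∀ r ∈ L, r.toSequent ∈ e.sequents := fun r hr => (hL _).2 ⟨r, hr, rfl⟩
    -- If α₀ is not derived, realizability of the disjunction guarantees α₁.
    let i := !memb x.α₀ ((saturate G L).map Prod.snd)
    let α := bif i then x.α₁ else x.α₀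
    have hα : α ∈ (saturate G L).map Prod.snd := by
      cases h : memb x.α₀ ((saturate G L).map Prod.snd) with
      | true => simpa [α, i, h] using memb_iff.1 h
      | false =>
        simp only [α, i, h, Bool.not_false, cond_true]
        rcases hr with ⟨hr, _⟩ | ⟨hr, _⟩
        · exact absurd (memb_iff.2 hr) (by rw [h]; simp)
        · exact hr
    have hchain := chain_saturate G L
    -- The picked sequent need not be the last of the chain; its antecedent is covered by `G` and
    -- the succedents of the whole chain, which is the invariant needed to start cutting.
    have hsub : ∀ {F}, Chain G L F → ∀ r ∈ F, r ∈ L ∧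
        ∀ φ ∈ r.1, φ ∈ G ∨ φ ∈ F.map Prod.snd := by
      intro F hF
      induction hF with
      | nil => simp
      | snoc hF hr h ih =>
        intro r hr'
        rw [List.mem_append, List.mem_singleton] at hr'
        simp only [List.map_append, List.mem_append]
        rcases hr' with hr' | rfl
        · exact ⟨(ih r hr').1, fun φ hφ => ((ih r hr').2 φ hφ).imp_right .inl⟩
        · exact ⟨hr, fun φ hφ => (h φ hφ).imp_right .inl⟩
    obtain ⟨hp, hp'⟩ := hsub hchain _ (pick_mem hα)
    have hstart := cutDeducible_start (hL' _ hp)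
    rw [pick_snd] at hstart
    obtain ⟨⟨d, h₁, h₂, h₃⟩, h₄⟩ := hchain.cutDeducible_foldr hL'
      (s := ((pick (saturate G L) α).1, inferT 0 (pick (saturate G L) α).1 α [])) hstart hp'
    refine ⟨(i, d), ⟨h₂, ?_, ?_⟩, _, h₁, rfl⟩
    · rw [h₃, ← hG]
      intro φ hφ
      exact List.mem_toFinset.2 (h₄ φ (List.mem_toFinset.1 hφ))
    · rw [h₃]
      change α = if i then x.α₁ else x.α₀
      cases h : i <;> simp [α, h]
  · obtain ⟨r, hr, rfl⟩ := (hL s).1 hs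
    refine mem_saturate hr (fires_iff.2 fun φ h => ?_)
    simpa using hφ φ (List.mem_toFinset.2 h)
  · rw [he.2] at hφ
    refine ⟨.inl (hG ▸ hφ), ?_⟩
    obtain ⟨γ, _, rfl⟩ := Finset.mem_image.1 hφ
    exact Formula.realized_of_disjPos (Formula.disjPos_choose _ _)

theorem IsPolyTimeTransformation.solvable {T : Instance → Derivation}
    (hT : IsPolyTimeTransformation T) :
    SolvableInPolyTime Instance.IsCode solutionIsCode (fun x y => x.IsSolution (T x) y) := by
  obtain ⟨hd, q, C, hq⟩ := hT
  have h : PolyTime fun v : Tree => (sequentsT (.node v .nil), v.rgt.lft) := by fun_prop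
  obtain ⟨p, B, hp⟩ := PolyTime.disjunct.comp_enc h
  -- A `call` in `q` refers to the whole program `q`; wrapping it in `mu` preserves this inside a
  -- larger program. The program `p` runs within any body.
  refine ⟨.comp p (.mu q), C + B.comp C + 2 * (.X + 1), fun x w hw => ?_⟩
  obtain ⟨_, v, t, rfl, hv, ht, ht'⟩ := hq x w hw
  obtain ⟨L, hL, hL'⟩ := hv.codesSequents
  obtain ⟨G, hG, hv'⟩ := hv.concl.exists_list
  rw [(hd x).2] at hG hv'
  obtain ⟨y, hy, hy'⟩ := x.isSolution_disjunct (hd x) hL' hG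
  obtain ⟨s, hs, hs'⟩ := hp (.comp p (.mu q)) v (L, G, .or x.α₀ x.α₁) (by
    change Tree.node (.ofList (List.map enc _)) _ = Tree.node (.ofList (L.map enc)) _
    rw [hv', hL]
    congr 2
    exact List.map_id _)
  refine ⟨y, _, _, hy, hy', .comp (.mu ht) hs, ?_⟩
  have h₁ : s ≤ B.eval (C.eval w.size) :=
    hs'.trans (Polynomial.eval_mono_nat B (ht.size_le.trans ht'))
  simp
  omega

end IPC

theorem mainTheorem2 :
    IPC.SolvableInPolyTime IPC.Cedent.IsCode (fun E w => w = IPC.enumCode E) IPC.IsEnumeration ∧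
    (∃ T : IPC.Instance → IPC.Derivation, IPC.IsPolyTimeTransformation T) ∧
    ∀ T : IPC.Instance → IPC.Derivation, IPC.IsPolyTimeTransformation T →
      IPC.SolvableInPolyTime IPC.Instance.IsCode IPC.solutionIsCode
        (fun x y => x.IsSolution (T x) y) :=
  ⟨IPC.enumeration_solvable, ⟨_, IPC.isPolyTimeTransformation_transform⟩,
    fun _ hT => hT.solvable⟩
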